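/- Let $k\ge 1$ be an integer, let $c,f\in C^\infty([0,1])$, and let $c(x)\ge\tilde\gamma^2>0$ on $[0,1]$ for some constant $\tilde\gamma$. For $0<\varepsilon<1/2$ let $u$ be the solution of $$-\varepsilon^2u''+cu=f\ \text{ in }(0,1),\qquad u(0)=u(1)=0 .$$ **Mesh.** For $H\in(0,1)$ put $x_i=iH\varepsilon$ for $0\le i<\lfloor 1/H\rfloor+1$ and $x_i=(1+H)x_{i-1}$ for $\lfloor 1/H\rfloor+1\le i\le M-1$, where $M$ is determined by $x_{M-1}<1/2\le(1+H)x_{M-1}$; put $x_M=1/2$ and $x_{M+i}=1-x_{M-i}$ for $1\le i\le M$. This is the Durán–Lombardi mesh on $[0,1]$, with $N=2M$ subintervals. One is also allowed to omit the two nodes $x_{M-1},x_{M+1}$ (as is done when the interval $(x_{M-1},1/2)$ is too small) and to renumber the remaining nodes; then $N=2M-2$. **Method.** Let $I_i=(x_{i-1},x_i)$, $1\le i\le N$. For piecewise smooth $v$ let $[v]_i=v(x_i+0)-v(x_i-0)$ and $\langle v\rangle_i=\frac12\bigl(v(x_i+0)+v(x_i-0)\bigr)$ for $1\le i\le N-1$,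 $[v]_0=\langle v\rangle_0=v(x_0+0)$ and $[v]_N=-\langle v\rangle_N=-v(x_N-0)$. Let $\sigma_0=\sigma_N=\varepsilon$, $\sigma_i=\varepsilon H^{-1}$ for $1\le i\le N-1$, and $$a(w,v)=\sum_{i=1}^N\int_{I_i}\bigl(\varepsilon^2w'v'+cwv\bigr)\,dx+\sum_{i=0}^N\Bigl(\varepsilon^2\langle w'\rangle_i[v]_i-\varepsilon^2[w]_i\langle v'\rangle_i+\sigma_i[w]_i[v]_i\Bigr),\qquad \|w\|_{dG}=a(w,w)^{1/2}.$$ Let $V^N$ be the space of functions that are polynomials of degree at most $k$ on each $I_i$, and let $u^N\in V^N$ be the solution of the NIPG method, $a(u^N,v)=\sum_{i=1}^N\int_{I_i}fv\,dx$ for all $v\in V^N$. **Claim.** There is a constant $C>0$, depending on $k,c,f,\tilde\gamma$ but not on $\varepsilon$, $H$ or $N$, such that for all $0<\varepsilon<1/2$ and $0<H<1$ $$\|u-u^N\|_{dG}\le CH^{k+1}+C\bigl(\varepsilon\ln(1/\varepsilon)\bigr)^{1/2}H^k ,$$ and moreover $H\le C\,\ln(1/\varepsilon)/N$ and $$\|u-u^N\|_{dG}\le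 C\,N^{-k}\bigl(\ln(1/\varepsilon)\bigr)^k .$$ -/

import Mathlib

open scoped ContDiff

noncomputable section

/-- `u` is the classical solution of `-ε² u'' + c u = f` in `(0, 1)`, `u(0) = u(1) = 0`. -/
structure IsReactionDiffusionSolution (ε : ℝ) (c f u : ℝ → ℝ) : Prop where
  continuousOn : ContinuousOn u (Set.Icc 0 1)
  contDiffOn : ContDiffOn ℝ 2 u (Set.Ioo 0 1)
  equation : ∀ x ∈ Set.Ioo (0 : ℝ) 1, -ε ^ 2 * deriv (deriv u) x + c x * u x = f x
  left_bc : u 0 = 0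
  right_bc : u 1 = 0

/-! A mesh with `N` subintervals is given by its nodes `x 0, …, x N`. Its elements are
`(x i, x (i + 1))`, `i < N`. Piecewise smooth functions are functions `ℝ → ℝ`; their values at
the nodes and outside of the mesh never enter, only one-sided limits and integrals do. -/

/-- The jump of `v` at the node `x i`: `v(x_i + 0) - v(x_i - 0)` at interior nodes,
`v(x_0 + 0)` at the first and `-v(x_N - 0)` at the last node. -/
def nodeJump (N : ℕ) (x : ℕ → ℝ) (v : ℝ → ℝ) (i : ℕ) : ℝ :=
  if i = 0 then Function.rightLim v (x 0)
  else if i = N then -Function.leftLim v (x N)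
  else Function.rightLim v (x i) - Function.leftLim v (x i)

/-- The average of `v` at the node `x i`: `(v(x_i + 0) + v(x_i - 0)) / 2` at interior nodes,
`v(x_0 + 0)` at the first and `v(x_N - 0)` at the last node. -/
def nodeAverage (N : ℕ) (x : ℕ → ℝ) (v : ℝ → ℝ) (i : ℕ) : ℝ :=
  if i = 0 then Function.rightLim v (x 0)
  else if i = N then Function.leftLim v (x N)
  else (Function.rightLim v (x i) + Function.leftLim v (x i)) / 2

/-- The Galerkin part `∑ᵢ ∫_{Iᵢ} (ε² w' v' + c w v)` of the bilinear form. -/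
def galerkinForm (ε : ℝ) (c : ℝ → ℝ) (N : ℕ) (x : ℕ → ℝ) (w v : ℝ → ℝ) : ℝ :=
  ∑ i ∈ Finset.range N,
    ∫ t in (x i)..(x (i + 1)), (ε ^ 2 * deriv w t * deriv v t + c t * w t * v t)

/-- The NIPG bilinear form with penalty parameters `σ 0, …, σ N`. -/
def nipgForm (ε : ℝ) (c : ℝ → ℝ) (N : ℕ) (x σ : ℕ → ℝ) (w v : ℝ → ℝ) : ℝ :=
  galerkinForm ε c N x w v +
    ∑ i ∈ Finset.range (N + 1),
      (ε ^ 2 * nodeAverage N x (deriv w) i * nodeJump N x v i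
        - ε ^ 2 * nodeJump N x w i * nodeAverage N x (deriv v) i
        + σ i * nodeJump N x w i * nodeJump N x v i)

/-- The load functional `l(v) = ∑ᵢ ∫_{Iᵢ} f v`. -/
def nipgLoad (f : ℝ → ℝ) (N : ℕ) (x : ℕ → ℝ) (v : ℝ → ℝ) : ℝ :=
  ∑ i ∈ Finset.range N, ∫ t in (x i)..(x (i + 1)), f t * v t

/-- The energy norm `‖w‖_dG = a(w, w)^{1/2}`. -/
def dGNorm (ε : ℝ) (c : ℝ → ℝ) (N : ℕ) (x σ : ℕ → ℝ) (w : ℝ → ℝ) : ℝ :=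
  Real.sqrt (nipgForm ε c N x σ w w)

/-- The finite element space: functions that are polynomials of degree at most `k` on every
(open) element. -/
def dGSpace (k N : ℕ) (x : ℕ → ℝ) : Set (ℝ → ℝ) :=
  {v | ∀ i < N, ∃ p : Polynomial ℝ, p.natDegree ≤ k ∧
    ∀ t ∈ Set.Ioo (x i) (x (i + 1)), v t = p.eval t}

/-- `uN` solves the discrete problem: `uN ∈ V^N` and `a(uN, v) = l(v)` for all `v ∈ V^N`. -/
def IsNIPGSolution (ε : ℝ) (c f : ℝ → ℝ) (k N : ℕ) (x σ : ℕ → ℝ) (uN : ℝ → ℝ) : Prop :=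
  uN ∈ dGSpace k N x ∧
    ∀ v ∈ dGSpace k N x, nipgForm ε c N x σ uN v = nipgLoad f N x v

/-- The recursive sequence `x_i = i H ε` for `0 ≤ i < ⌊1/H⌋ + 1` and `x_i = (1 + H) x_{i-1}`
from `i = ⌊1/H⌋ + 1` on. -/
def gradedSeq (ε H : ℝ) : ℕ → ℝ
  | 0 => 0
  | i + 1 =>
    if i + 1 < ⌊1 / H⌋₊ + 1 then ((i + 1 : ℕ) : ℝ) * H * ε else (1 + H) * gradedSeq ε H i

/-- `M` is the index at which the recursion is stopped: `x_{M-1} < 1/2 ≤ (1 + H) x_{M-1}`. -/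
def IsGradedStop (ε H : ℝ) (M : ℕ) : Prop :=
  1 ≤ M ∧ gradedSeq ε H (M - 1) < 1 / 2 ∧ 1 / 2 ≤ (1 + H) * gradedSeq ε H (M - 1)

/-- The mesh with `2 m` subintervals whose nodes are `x_0, …, x_{m-1}` from the recursion,
`x_m = 1/2`, and their reflections `x_{m+i} = 1 - x_{m-i}`. -/
def gradedNode (ε H : ℝ) (m i : ℕ) : ℝ :=
  if i < m then gradedSeq ε H i
  else if i = m then 1 / 2
  else 1 - gradedSeq ε H (2 * m - i)

/-- `gradedNode ε H m` is a Durán–Lombardi mesh: either `m` is the stopping index `M`, or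
`m = M - 1`, which is the mesh obtained from the former by omitting `x_{M-1}` and `x_{M+1}`. -/
def IsDuranLombardi (ε H : ℝ) (m : ℕ) : Prop :=
  IsGradedStop ε H m ∨ IsGradedStop ε H (m + 1)

/-- The penalty parameters: `ε` at the two boundary nodes and `ε / H` at the interior nodes. -/
def gradedPenalty (ε H : ℝ) (N i : ℕ) : ℝ :=
  if i = 0 ∨ i = N then ε else ε * H⁻¹

end

/-! Everything rests on how the derivatives of `u` scale. With `d = x (1 - x)`, comparable to the
distance to the boundary, `exists_bound_iteratedDeriv_solution` gives `max ε d ^ j * |u^(j)| ≤ K`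
with `K` independent of `ε`. This replaces a decomposition into a smooth part and exponential
layers, and it is what the mesh is built for: an element has length at most `3 H R` with `R ≤ 2 max
ε d` on it (`IsDuranLombardi.exists_scale`). Interpolation of degree `k` there has error
`O(H^(k+1))` in value and `O(H^k / R)` in the derivative, since the powers of `R` cancel.

The bound with `ε ^ j` follows from the maximum principle and the differentiated equation. The bound
with `d ^ j` is proved by Bernstein's method: for `a = d^(n+1) u^(n+1)` and `b = d^n u^(n)`, the
function `a² + 4 L b²` is maximized where `d ≥ ε`. At an interior maximum the reaction term controls
`a²`, while the terms caused by differentiating the weight are absorbed by the part of `(b')²` that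
contains `(a / d)²`.

For the method itself, the two nonsymmetric flux terms cancel in `a(e, e)`, so the energy is the
Galerkin part plus the penalized jumps. By consistency the error `e = u - uN` is orthogonal to the
discrete space, hence `a(e, e) = a(e, η)` for the error `η` of a nodally exact interpolant. As `η`
has no jumps, Young's inequality bounds the energy by the Galerkin energy of `η` and by the terms
`ε⁴ ⟨η'⟩² / σ` (`nipgForm_error_le`); no inverse inequality is needed.

Summation uses `N H ≤ 10 log (1 / ε)`: each element contributes at most a constant times `ε H ^ (2 k
+ 1)` to the squared gradient term, which is the source of the factor `ε log (1 / ε)`. The reaction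
term gives `H ^ (2 k + 2)`. -/

open Set Filter Topology MeasureTheory

/-! ### Calculus preliminaries -/

/-- The necessary second order condition at a local maximum. -/
theorem IsLocalMax.second_deriv_nonpos {W W' : ℝ → ℝ} {w x : ℝ} (hmax : IsLocalMax W x)
    (hW : ∀ᶠ y in 𝓝 x, HasDerivAt W (W' y) y) (hW' : HasDerivAt W' w x) : w ≤ 0 := by
  by_contra! hw
  have hd : deriv W =ᶠ[𝓝 x] W' := hW.mono fun y hy => hy.deriv
  have hdd : deriv (deriv W) x = w := by rw [hd.deriv_eq, hW'.deriv]
  -- A positive second derivative would make the maximum also a local minimum; then `W` is locally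
  -- constant and its second derivative vanishes.
  have hmin : IsLocalMin W x :=
    isLocalMin_of_deriv_deriv_pos (by rw [hdd]; exact hw) hmax.deriv_eq_zero
      hW.self_of_nhds.continuousAt
  have hconst : W =ᶠ[𝓝 x] fun _ => W x := by
    filter_upwards [hmax, hmin] with y h1 h2 using le_antisymm h1 h2
  have h0 : deriv W =ᶠ[𝓝 x] fun _ => 0 := by
    filter_upwards [hconst.eventuallyEq_nhds] with y hy
    rw [hy.deriv_eq]; simp
  rw [h0.deriv_eq] at hdd
  simp at hdd
  exact hw.ne hdd

/-- Compactness bounds the one-sided derivatives on the closed interval. Two-sided ones agree with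
them only in the interior, since nothing is assumed outside `[0, 1]`. -/
theorem ContDiffOn.exists_bound_iteratedDeriv {c : ℝ → ℝ} (hc : ContDiffOn ℝ ∞ c (Icc 0 1))
    (j : ℕ) : ∃ B, 0 ≤ B ∧ ∀ x ∈ Ioo (0 : ℝ) 1, |iteratedDeriv j c x| ≤ B := by
  have hcont := hc.continuousOn_iteratedDerivWithin (m := j) (by exact_mod_cast le_top)
    (uniqueDiffOn_Icc zero_lt_one)
  obtain ⟨B, hB⟩ := isCompact_Icc.exists_bound_of_continuousOn hcont
  refine ⟨B, (norm_nonneg _).trans (hB 0 (by simp)), fun x hx => ?_⟩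
  have h1 : ContDiffAt ℝ j c x := by
    refine (hc.contDiffAt (Icc_mem_nhds hx.1 hx.2)).of_le (by exact_mod_cast le_top)
  rw [← iteratedDerivWithin_eq_iteratedDeriv (uniqueDiffOn_Icc zero_lt_one) h1
    (Ioo_subset_Icc_self hx)]
  exact hB x (Ioo_subset_Icc_self hx)

theorem ContDiffOn.hasDerivAt_iteratedDeriv {u : ℝ → ℝ} {s : Set ℝ} (hu : ContDiffOn ℝ ∞ u s)
    (hs : IsOpen s) (j : ℕ) {x : ℝ} (hx : x ∈ s) :
    HasDerivAt (iteratedDeriv j u) (iteratedDeriv (j + 1) u x) x := by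
  rw [iteratedDeriv_succ]
  have h := (hu.differentiableOn_iteratedDerivWithin (m := j)
    (by exact_mod_cast WithTop.coe_lt_top j) hs.uniqueDiffOn)
  have h2 : DifferentiableAt ℝ (iteratedDerivWithin j u s) x :=
    (h x hx).differentiableAt (hs.mem_nhds hx)
  have he : iteratedDerivWithin j u s =ᶠ[𝓝 x] iteratedDeriv j u := by
    filter_upwards [hs.mem_nhds hx] with y hy using iteratedDerivWithin_of_isOpen hs hy
  exact (he.differentiableAt_iff.1 h2).hasDerivAt

/-! ### Interior regularity, the differentiated equation and the maximum principle -/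

namespace IsReactionDiffusionSolution

variable {ε : ℝ} {c f u : ℝ → ℝ}

theorem deriv_deriv_eq (hu : IsReactionDiffusionSolution ε c f u) (hε : 0 < ε) {x : ℝ}
    (hx : x ∈ Ioo (0 : ℝ) 1) : deriv (deriv u) x = (c x * u x - f x) / ε ^ 2 := by
  have h := hu.equation x hx
  rw [eq_div_iff (by positivity)]
  linarith

/-- Bootstrapping: the equation expresses `u''` through `u`, so each order of smoothness of `u`
passes to `u''`. -/
theorem contDiffOn_infty (hu : IsReactionDiffusionSolution ε c f u) (hε : 0 < ε)
    (hc : ContDiffOn ℝ ∞ c (Icc 0 1)) (hf : ContDiffOn ℝ ∞ f (Icc 0 1)) :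
    ContDiffOn ℝ ∞ u (Ioo 0 1) := by
  rw [_root_.contDiffOn_infty]
  have hcn : ∀ n : ℕ, ContDiffOn ℝ n c (Ioo 0 1) := fun n =>
    (hc.mono Ioo_subset_Icc_self).of_le (by exact_mod_cast le_top)
  have hfn : ∀ n : ℕ, ContDiffOn ℝ n f (Ioo 0 1) := fun n =>
    (hf.mono Ioo_subset_Icc_self).of_le (by exact_mod_cast le_top)
  have h1 := (contDiffOn_succ_iff_deriv_of_isOpen (n := 1) isOpen_Ioo).1
    (by simpa [one_add_one_eq_two] using hu.contDiffOn)
  have h2 := (contDiffOn_succ_iff_deriv_of_isOpen (n := 0) isOpen_Ioo).1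
    (by simpa using h1.2.2)
  have key : ∀ n : ℕ, ContDiffOn ℝ n u (Ioo 0 1) → ContDiffOn ℝ (n + 1 : ℕ) u (Ioo 0 1) := by
    intro n hn
    have hdd : ContDiffOn ℝ n (deriv (deriv u)) (Ioo 0 1) := by
      have : ContDiffOn ℝ n (fun x => (c x * u x - f x) / ε ^ 2) (Ioo 0 1) :=
        (((hcn n).mul hn).sub (hfn n)).div_const _
      exact this.congr fun x hx => hu.deriv_deriv_eq hε hx
    have hd : ContDiffOn ℝ ((n : ℕ∞ω) + 1) (deriv u) (Ioo 0 1) :=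
      (contDiffOn_succ_iff_deriv_of_isOpen isOpen_Ioo).2 ⟨h2.1, by simp, hdd⟩
    have := (contDiffOn_succ_iff_deriv_of_isOpen (n := (n : ℕ∞ω)) isOpen_Ioo).2
      ⟨h1.1, by simp, hd.of_le (by exact_mod_cast Nat.le_succ n)⟩
    exact_mod_cast this
  intro n
  induction n with
  | zero => exact hu.contDiffOn.of_le (by simp)
  | succ n ih => exact key n ih

/-- The equation differentiated `j` times. -/
theorem iteratedDeriv_equation (hu : IsReactionDiffusionSolution ε c f u) (hε : 0 < ε)
    (hc : ContDiffOn ℝ ∞ c (Icc 0 1)) (hf : ContDiffOn ℝ ∞ f (Icc 0 1)) (j : ℕ) {x : ℝ}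
    (hx : x ∈ Ioo (0 : ℝ) 1) :
    ε ^ 2 * iteratedDeriv (j + 2) u x =
      ∑ i ∈ Finset.range (j + 1),
        (j.choose i : ℝ) * iteratedDeriv i c x * iteratedDeriv (j - i) u x
      - iteratedDeriv j f x := by
  have hU := hu.contDiffOn_infty hε hc hf
  have hux : ContDiffAt ℝ j u x :=
    (hU.contDiffAt (isOpen_Ioo.mem_nhds hx)).of_le (by exact_mod_cast le_top)
  have hcx : ContDiffAt ℝ j c x :=
    (hc.contDiffAt (Icc_mem_nhds hx.1 hx.2)).of_le (by exact_mod_cast le_top)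
  have hfx : ContDiffAt ℝ j f x :=
    (hf.contDiffAt (Icc_mem_nhds hx.1 hx.2)).of_le (by exact_mod_cast le_top)
  rw [iteratedDeriv_succ', iteratedDeriv_succ', ← iteratedDeriv_const_mul_field]
  have he : (fun y => ε ^ 2 * deriv (deriv u) y) =ᶠ[𝓝 x] (c * u - f) := by
    filter_upwards [isOpen_Ioo.mem_nhds hx] with y hy
    have := hu.equation y hy
    simp only [Pi.sub_apply, Pi.mul_apply]
    linarith
  rw [he.iteratedDeriv_eq, iteratedDeriv_sub (f := c * u) (hcx.mul hux) hfx,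
    iteratedDeriv_mul hcx hux]

end IsReactionDiffusionSolution

namespace IsReactionDiffusionSolution

variable {ε : ℝ} {c f u : ℝ → ℝ}

theorem neg (hu : IsReactionDiffusionSolution ε c f u) :
    IsReactionDiffusionSolution ε c (-f) (-u) where
  continuousOn := hu.continuousOn.neg
  contDiffOn := hu.contDiffOn.neg
  equation x hx := by
    have h := hu.equation x hx
    have h1 : deriv (-u) = -deriv u := by ext y; exact deriv.neg
    have h2 : deriv (-deriv u) x = -deriv (deriv u) x := deriv.neg
    rw [h1, h2]
    simp only [Pi.neg_apply]
    linarith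
  left_bc := by simp [hu.left_bc]
  right_bc := by simp [hu.right_bc]

/-- Maximum principle: at an interior maximum `u'' ≤ 0`, so `c u ≤ f` there. `0 ≤ F` covers maxima
at the end points and nonpositive maxima. -/
theorem le_of_le (hu : IsReactionDiffusionSolution ε c f u) {γ F : ℝ}
    (hγ : 0 < γ ^ 2) (hcγ : ∀ x ∈ Icc (0 : ℝ) 1, γ ^ 2 ≤ c x) (hF : 0 ≤ F)
    (hf : ∀ x ∈ Ioo (0 : ℝ) 1, f x ≤ F) {x : ℝ} (hx : x ∈ Icc (0 : ℝ) 1) :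
    u x ≤ F / γ ^ 2 := by
  obtain ⟨y, hy, hmax⟩ := isCompact_Icc.exists_isMaxOn ⟨x, hx⟩ hu.continuousOn
  refine (hmax hx : u x ≤ u y).trans ?_
  rcases eq_endpoints_or_mem_Ioo_of_mem_Icc hy with h | h | h
  · rw [h, hu.left_bc]; positivity
  · rw [h, hu.right_bc]; positivity
  · have h1 := (contDiffOn_succ_iff_deriv_of_isOpen (n := 1) isOpen_Ioo).1
      (by simpa [one_add_one_eq_two] using hu.contDiffOn)
    have h2 := (contDiffOn_succ_iff_deriv_of_isOpen (n := 0) isOpen_Ioo).1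
      (by simpa using h1.2.2)
    have hloc : IsLocalMax u y := hmax.isLocalMax (Icc_mem_nhds h.1 h.2)
    have h3 : deriv (deriv u) y ≤ 0 := by
      refine hloc.second_deriv_nonpos (W' := deriv u) ?_
        ((h2.1 y h).differentiableAt (isOpen_Ioo.mem_nhds h)).hasDerivAt
      filter_upwards [isOpen_Ioo.mem_nhds h] with z hz
      exact ((h1.1 z hz).differentiableAt (isOpen_Ioo.mem_nhds hz)).hasDerivAt
    have h4 := hu.equation y h
    have h5 := hcγ y hy
    rw [le_div_iff₀ hγ]
    rcases le_or_gt (u y) 0 with h6 | h6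
    · nlinarith
    · have := hf y h
      nlinarith [mul_nonneg (sq_nonneg ε) (neg_nonneg.2 h3)]

theorem abs_le (hu : IsReactionDiffusionSolution ε c f u) {γ F : ℝ}
    (hγ : 0 < γ ^ 2) (hcγ : ∀ x ∈ Icc (0 : ℝ) 1, γ ^ 2 ≤ c x) (hF : 0 ≤ F)
    (hf : ∀ x ∈ Ioo (0 : ℝ) 1, |f x| ≤ F) {x : ℝ} (hx : x ∈ Icc (0 : ℝ) 1) :
    |u x| ≤ F / γ ^ 2 := by
  refine abs_le'.2 ⟨hu.le_of_le hγ hcγ hF (fun y hy => (le_abs_self _).trans (hf y hy)) hx, ?_⟩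
  exact hu.neg.le_of_le hγ hcγ hF (fun y hy => (neg_le_abs _).trans (hf y hy)) hx

end IsReactionDiffusionSolution

/-! ### Derivative bounds in powers of `ε` -/

/-- A weighted bound for a part of the Leibniz sum. -/
theorem pow_mul_abs_leibniz_le {j : ℕ} {S : Finset ℕ} {w : ℝ} (hw : 0 ≤ w) (hw1 : w ≤ 1)
    {C B U K : ℕ → ℝ} (hC : ∀ i, |C i| ≤ B i)
    (hU : ∀ i ∈ S, w ^ (j - i) * |U (j - i)| ≤ K (j - i)) :
    w ^ j * |∑ i ∈ S, (j.choose i : ℝ) * C i * U (j - i)|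
      ≤ ∑ i ∈ S, (j.choose i : ℝ) * B i * K (j - i) := by
  calc w ^ j * |∑ i ∈ S, (j.choose i : ℝ) * C i * U (j - i)|
      ≤ w ^ j * ∑ i ∈ S, |(j.choose i : ℝ) * C i * U (j - i)| := by
        gcongr; exact Finset.abs_sum_le_sum_abs _ _
    _ = ∑ i ∈ S, (j.choose i : ℝ) * |C i| * (w ^ j * |U (j - i)|) := by
        rw [Finset.mul_sum]
        refine Finset.sum_congr rfl fun i _ => ?_
        rw [abs_mul, abs_mul, Nat.abs_cast]; ring
    _ ≤ _ := by
        refine Finset.sum_le_sum fun i hi => ?_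
        have h0 : 0 ≤ B i := (abs_nonneg _).trans (hC i)
        have h1 : w ^ j * |U (j - i)| ≤ K (j - i) := by
          refine le_trans ?_ (hU i hi)
          gcongr ?_ * _
          exact pow_le_pow_of_le_one hw hw1 (Nat.sub_le j i)
        have := hC i
        gcongr

/-- The differentiated equation trades two derivatives for `ε⁻²`, so the induction advances by two.
Order zero is the maximum principle; order one is interpolated between orders zero and two on an
interval of length `ε`. -/
theorem exists_bound_eps_pow_mul_iteratedDeriv {c f : ℝ → ℝ}
    (hc : ContDiffOn ℝ ∞ c (Icc 0 1)) (hf : ContDiffOn ℝ ∞ f (Icc 0 1))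
    {γ : ℝ} (hγ : 0 < γ ^ 2) (hcγ : ∀ x ∈ Icc (0 : ℝ) 1, γ ^ 2 ≤ c x) (j : ℕ) :
    ∃ K, 0 ≤ K ∧ ∀ ε : ℝ, 0 < ε → ε < 1 / 2 → ∀ u, IsReactionDiffusionSolution ε c f u →
      ∀ x ∈ Ioo (0 : ℝ) 1, ε ^ j * |iteratedDeriv j u x| ≤ K := by
  choose Bc hBc0 hBc using fun j => hc.exists_bound_iteratedDeriv j
  choose Bf hBf0 hBf using fun j => hf.exists_bound_iteratedDeriv j
  induction j using Nat.strong_induction_on with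
  | _ j ih =>
  have h0 : ∃ K, 0 ≤ K ∧ ∀ ε : ℝ, 0 < ε → ε < 1 / 2 → ∀ u, IsReactionDiffusionSolution ε c f u →
      ∀ x ∈ Ioo (0 : ℝ) 1, ε ^ 0 * |iteratedDeriv 0 u x| ≤ K := by
    refine ⟨Bf 0 / γ ^ 2, div_nonneg (hBf0 0) hγ.le, fun ε _ _ u hu x hx => ?_⟩
    simpa using hu.abs_le hγ hcγ (hBf0 0) (fun y hy => by simpa using hBf 0 y hy)
      (Ioo_subset_Icc_self hx)
  have hstep : ∀ i, (∀ m ≤ i, ∃ K, 0 ≤ K ∧ ∀ ε : ℝ, 0 < ε → ε < 1 / 2 → ∀ u,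
      IsReactionDiffusionSolution ε c f u →
      ∀ x ∈ Ioo (0 : ℝ) 1, ε ^ m * |iteratedDeriv m u x| ≤ K) →
      ∃ K, 0 ≤ K ∧ ∀ ε : ℝ, 0 < ε → ε < 1 / 2 → ∀ u, IsReactionDiffusionSolution ε c f u →
      ∀ x ∈ Ioo (0 : ℝ) 1, ε ^ (i + 2) * |iteratedDeriv (i + 2) u x| ≤ K := by
    intro i hi
    choose! K hK0 hK using hi
    refine ⟨∑ m ∈ Finset.range (i + 1), (i.choose m : ℝ) * Bc m * K (i - m) + Bf i, ?_, ?_⟩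
    · refine add_nonneg (Finset.sum_nonneg fun m _ => ?_) (hBf0 i)
      exact mul_nonneg (mul_nonneg (Nat.cast_nonneg _) (hBc0 m)) (hK0 _ (Nat.sub_le _ _))
    intro ε hε hε2 u hu x hx
    have heq := hu.iteratedDeriv_equation hε hc hf i hx
    have hε1 : ε ≤ 1 := by linarith
    calc ε ^ (i + 2) * |iteratedDeriv (i + 2) u x|
        = ε ^ i * |ε ^ 2 * iteratedDeriv (i + 2) u x| := by
          rw [abs_mul, abs_of_nonneg (by positivity : 0 ≤ ε ^ 2)]; ring
      _ ≤ ε ^ i * (|∑ m ∈ Finset.range (i + 1),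
            (i.choose m : ℝ) * iteratedDeriv m c x * iteratedDeriv (i - m) u x|
            + |iteratedDeriv i f x|) := by
          rw [heq]; gcongr; exact abs_sub _ _
      _ ≤ _ := by
          rw [mul_add]
          refine add_le_add ?_ ?_
          · exact pow_mul_abs_leibniz_le (C := fun m => iteratedDeriv m c x)
              (U := fun m => iteratedDeriv m u x) hε.le hε1 (fun m => hBc m x hx)
              (fun m _ => hK _ (Nat.sub_le _ _) ε hε hε2 u hu x hx)
          · exact (mul_le_of_le_one_left (abs_nonneg _) (pow_le_one₀ hε.le hε1)).trans (hBf i x hx)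
  match j, ih with
  | 0, _ => exact h0
  | 1, _ =>
    obtain ⟨K0, hK0, hK⟩ := h0
    obtain ⟨K2, hK2, hK'⟩ := hstep 0 (fun m hm => by
      obtain rfl : m = 0 := by omega
      exact ⟨K0, hK0, hK⟩)
    refine ⟨2 * K0 + K2, by positivity, fun ε hε hε2 u hu x hx => ?_⟩
    have hU := hu.contDiffOn_infty hε hc hf
    have hbound : ∀ y ∈ Ioo (0 : ℝ) 1, |u y| ≤ K0 := fun y hy => by
      simpa using hK ε hε hε2 u hu y hy
    -- The mean value theorem on an interval of length `ε` gives a point with the desired bound on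
    -- `u'`; the bound `K2 / ε ^ 2` on `u''` carries it over to `x`.
    obtain ⟨z, hz, hz1, hzε⟩ : ∃ z ∈ Ioo (0 : ℝ) 1, |x - z| ≤ ε ∧
        ε * |iteratedDeriv 1 u z| ≤ 2 * K0 := by
      have hmv : ∀ p q : ℝ, p ∈ Ioo (0 : ℝ) 1 → q ∈ Ioo (0 : ℝ) 1 → q - p = ε →
          ∃ z ∈ Ioo p q, ε * |iteratedDeriv 1 u z| ≤ 2 * K0 := by
        intro p q hp hq hpq
        have hsub : Icc p q ⊆ Ioo (0 : ℝ) 1 := fun y hy => ⟨hp.1.trans_le hy.1, hy.2.trans_lt hq.2⟩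
        have hd : ∀ y ∈ Ioo p q, HasDerivAt u (iteratedDeriv 1 u y) y := fun y hy => by
          simpa using hU.hasDerivAt_iteratedDeriv isOpen_Ioo 0 (hsub (Ioo_subset_Icc_self hy))
        obtain ⟨z, hz, he⟩ := exists_hasDerivAt_eq_slope u (iteratedDeriv 1 u)
          (by linarith : p < q) (hU.continuousOn.mono hsub) hd
        refine ⟨z, hz, ?_⟩
        rw [hpq] at he
        have h3 : ε * |iteratedDeriv 1 u z| = |u q - u p| := by
          rw [he, abs_div, abs_of_pos hε]; field_simp
        rw [h3]
        have := hbound p hp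
        have := hbound q hq
        have := abs_sub (u q) (u p)
        linarith
      -- As `ε < 1 / 2`, one of `x + ε` and `x - ε` stays in `(0, 1)`.
      rcases le_or_gt x (1 / 2) with h | h
      · obtain ⟨z, hz, h2⟩ := hmv x (x + ε) hx ⟨by linarith [hx.1], by linarith⟩ (by ring)
        exact ⟨z, ⟨hx.1.trans hz.1, by linarith [hz.2]⟩, by
          rw [abs_le]; constructor <;> linarith [hz.1, hz.2], h2⟩
      · obtain ⟨z, hz, h2⟩ := hmv (x - ε) x ⟨by linarith, by linarith [hx.2]⟩ hx (by ring)
        exact ⟨z, ⟨by linarith [hz.1], hz.2.trans hx.2⟩, by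
          rw [abs_le]; constructor <;> linarith [hz.1, hz.2], h2⟩
    have hlip : |iteratedDeriv 1 u x - iteratedDeriv 1 u z| ≤ K2 / ε ^ 2 * |x - z| := by
      have := (convex_Ioo (0 : ℝ) 1).norm_image_sub_le_of_norm_hasDerivWithin_le
        (f := iteratedDeriv 1 u) (f' := iteratedDeriv 2 u) (C := K2 / ε ^ 2)
        (fun y hy => (hU.hasDerivAt_iteratedDeriv isOpen_Ioo 1 hy).hasDerivWithinAt)
        (fun y hy => by
          rw [le_div_iff₀ (by positivity), mul_comm]
          exact hK' ε hε hε2 u hu y hy) hz hx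
      simpa using this
    have h1 : ε * |iteratedDeriv 1 u x - iteratedDeriv 1 u z| ≤ K2 := by
      calc _ ≤ ε * (K2 / ε ^ 2 * ε) := by gcongr; exact hlip.trans (by gcongr)
        _ = K2 := by field_simp
    have h2 : |iteratedDeriv 1 u x| ≤
        |iteratedDeriv 1 u z| + |iteratedDeriv 1 u x - iteratedDeriv 1 u z| := by
      have := abs_add_le (iteratedDeriv 1 u z) (iteratedDeriv 1 u x - iteratedDeriv 1 u z)
      simpa using this
    calc ε ^ 1 * |iteratedDeriv 1 u x| ≤ ε * (|iteratedDeriv 1 u z|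
          + |iteratedDeriv 1 u x - iteratedDeriv 1 u z|) := by rw [pow_one]; gcongr
      _ ≤ _ := by rw [mul_add]; exact add_le_add hzε h1
  | i + 2, ih => exact hstep i fun m hm => ih m (by omega)

/-! ### Weighted derivative bounds by Bernstein's method -/

theorem hasDerivAt_weight (y : ℝ) :
    HasDerivAt (fun y : ℝ => y * (1 - y)) (1 - 2 * y) y := by
  have h := (hasDerivAt_id y).mul ((hasDerivAt_const y (1 : ℝ)).sub (hasDerivAt_id y))
  refine h.congr_deriv ?_
  simp; ring

theorem weight_pos {y : ℝ} (hy : y ∈ Ioo (0 : ℝ) 1) : 0 < y * (1 - y) :=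
  mul_pos hy.1 (by linarith [hy.2])

theorem weight_le_one (y : ℝ) : y * (1 - y) ≤ 1 := by
  nlinarith [sq_nonneg (y - 1 / 2)]

/-- Writing the derivative through the logarithmic derivative of the weight reproduces the weighted
function itself, so no negative powers of the weight appear separately and the rule can be iterated.
-/
theorem hasDerivAt_weight_pow_mul (m : ℕ) {v : ℝ → ℝ} {v' y : ℝ} (hy : y ∈ Ioo (0 : ℝ) 1)
    (hv : HasDerivAt v v' y) :
    HasDerivAt (fun y => (y * (1 - y)) ^ m * v y)
      (m * ((1 - 2 * y) / (y * (1 - y))) * ((y * (1 - y)) ^ m * v y)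
        + (y * (1 - y)) ^ m * v') y := by
  refine (((hasDerivAt_weight y).pow m).mul hv).congr_deriv ?_
  have hd := (weight_pos hy).ne'
  congr 1
  rcases m with _ | m
  · simp
  · simp only [Nat.add_sub_cancel]
    generalize y * (1 - y) = d at *
    field_simp
    ring

/-- The logarithmic derivative of the weight `y (1 - y)` and its derivative. -/
theorem hasDerivAt_weight_logDeriv {y : ℝ} (hy : y ∈ Ioo (0 : ℝ) 1) :
    HasDerivAt (fun y : ℝ => (1 - 2 * y) / (y * (1 - y)))
      (-2 / (y * (1 - y)) - ((1 - 2 * y) / (y * (1 - y))) ^ 2) y := by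
  have hd := (weight_pos hy).ne'
  have h1 : HasDerivAt (fun y : ℝ => 1 - 2 * y) (-2) y := by
    refine ((hasDerivAt_const y (1 : ℝ)).sub ((hasDerivAt_id y).const_mul 2)).congr_deriv ?_
    simp
  refine (h1.div (hasDerivAt_weight y) hd).congr_deriv ?_
  generalize y * (1 - y) = d at *
  field_simp

theorem hasDerivAt_deriv_weight_pow_mul (m : ℕ) {v v' : ℝ → ℝ} {v'' y : ℝ}
    (hy : y ∈ Ioo (0 : ℝ) 1) (hv : HasDerivAt v (v' y) y) (hv' : HasDerivAt v' v'' y) :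
    HasDerivAt (fun y => m * ((1 - 2 * y) / (y * (1 - y))) * ((y * (1 - y)) ^ m * v y)
        + (y * (1 - y)) ^ m * v' y)
      ((m * (-2 / (y * (1 - y)) - ((1 - 2 * y) / (y * (1 - y))) ^ 2)
          - (m * ((1 - 2 * y) / (y * (1 - y)))) ^ 2) * ((y * (1 - y)) ^ m * v y)
        + 2 * (m * ((1 - 2 * y) / (y * (1 - y)))) *
          (m * ((1 - 2 * y) / (y * (1 - y))) * ((y * (1 - y)) ^ m * v y)
            + (y * (1 - y)) ^ m * v' y)
        + (y * (1 - y)) ^ m * v'') y := by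
  refine ((((hasDerivAt_weight_logDeriv hy).const_mul (m : ℝ)).mul
    (hasDerivAt_weight_pow_mul m hy hv)).add (hasDerivAt_weight_pow_mul m hy hv')).congr_deriv ?_
  ring

/-- The algebra behind the weighted gradient bound at an interior maximum of
`a² + 4 K b²`, where `θ = ε / d` and `S = ε d' / d`. -/
theorem bernstein_algebra {n α θ S S' a A A' b B B' c G G' g₁ g₂ β K γ : ℝ}
    (hn : 0 ≤ n) (hα : 0 ≤ α) (hθ0 : 0 ≤ θ) (hθ1 : θ ≤ 1) (hS : S ^ 2 ≤ θ ^ 2)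
    (hS' : -(3 * θ ^ 2) ≤ S')
    (hA' : A' = (α * S' - (α * S) ^ 2) * a + 2 * (α * S) * A + (c * a - G))
    (hB : B = n * S * b + θ * a)
    (hB' : B' = (n * S' - (n * S) ^ 2) * b + 2 * (n * S) * B + (c * b - G'))
    (hK : K = 3 * α + 2 * α ^ 2)
    (hc : γ ^ 2 ≤ c) (hb : |b| ≤ β) (hG : |G| ≤ g₁) (hG' : |G'| ≤ g₂)
    (hmax : A ^ 2 + a * A' + 4 * K * (B ^ 2 + b * B') ≤ 0) :
    γ ^ 2 * a ^ 2 ≤ |a| * g₁ + 4 * K * ((4 * n ^ 2 + 3 * n) * β ^ 2 + β * g₂) := by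
  have hK0 : 0 ≤ K := by rw [hK]; positivity
  have hβ : 0 ≤ β := (abs_nonneg _).trans hb
  have hθ2 : θ ^ 2 ≤ 1 := pow_le_one₀ hθ0 hθ1
  have haG : a * G ≤ |a| * g₁ := (le_abs_self _).trans (by rw [abs_mul]; gcongr)
  have hbG : b * G' ≤ β * g₂ := (le_abs_self _).trans (by rw [abs_mul]; gcongr)
  have hb2 : b ^ 2 ≤ β ^ 2 := by rw [← sq_abs b]; gcongr
  have hc0 : 0 ≤ c := (sq_nonneg γ).trans hc
  -- Completing the square removes the cross term in `A`. What the weight leaves is at worst `-(3 α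
  -- + 2 α²) θ² a²`, whence the choice of `K`.
  have h1 : c * a ^ 2 - |a| * g₁ - K * (θ ^ 2 * a ^ 2) ≤ A ^ 2 + a * A' := by
    have e1 : A ^ 2 + a * A' = (A + α * S * a) ^ 2 + c * a ^ 2 - a * G
        + α * (S' * a ^ 2) - 2 * α ^ 2 * (S ^ 2 * a ^ 2) := by rw [hA']; ring
    have e2 : α * (-(3 * θ ^ 2) * a ^ 2) ≤ α * (S' * a ^ 2) := by gcongr
    have e3 : 2 * α ^ 2 * (S ^ 2 * a ^ 2) ≤ 2 * α ^ 2 * (θ ^ 2 * a ^ 2) := by gcongr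
    have e4 := sq_nonneg (A + α * S * a)
    rw [e1, hK]
    linarith
  -- Since `B` contains `θ * a`, its square yields `θ² a² / 4` up to bounded terms. Multiplied by `4
  -- * K`, this cancels the loss in `h1` exactly.
  have h2 : θ ^ 2 * a ^ 2 / 4 - ((4 * n ^ 2 + 3 * n) * β ^ 2 + β * g₂) ≤ B ^ 2 + b * B' := by
    have e1 : B ^ 2 + b * B' = B ^ 2 / 2 + (B + 2 * n * S * b) ^ 2 / 2
        - 3 * (n ^ 2 * (S ^ 2 * b ^ 2))
        + n * (S' * b ^ 2) + c * b ^ 2 - b * G' := by rw [hB']; ring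
    have e2 : n * (-(3 * θ ^ 2) * b ^ 2) ≤ n * (S' * b ^ 2) := by gcongr
    have e3 : n ^ 2 * (S ^ 2 * b ^ 2) ≤ n ^ 2 * β ^ 2 := by
      have : S ^ 2 * b ^ 2 ≤ 1 * β ^ 2 := by
        gcongr; exact hS.trans hθ2
      rw [one_mul] at this
      gcongr
    have e4 : n * (θ ^ 2 * b ^ 2) ≤ n * β ^ 2 := by
      have : θ ^ 2 * b ^ 2 ≤ 1 * β ^ 2 := by gcongr
      rw [one_mul] at this
      gcongr
    have e5 : θ ^ 2 * a ^ 2 / 2 - n ^ 2 * (S ^ 2 * b ^ 2) ≤ B ^ 2 := by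
      have := sq_nonneg (θ * a + 2 * (n * S * b))
      rw [hB]; linarith
    have e6 : 0 ≤ c * b ^ 2 := by positivity
    have e7 : 0 ≤ n ^ 2 * β ^ 2 := by positivity
    have e8 := sq_nonneg (B + 2 * n * S * b)
    rw [e1]
    linarith
  have h3 := mul_le_mul_of_nonneg_left h2 (by positivity : 0 ≤ 4 * K)
  have h4 : γ ^ 2 * a ^ 2 ≤ c * a ^ 2 := by gcongr
  linarith

/-- Young's inequality `|a| g ≤ q a² / 2 + g² / (2 q)` absorbs the linear term. -/
theorem sq_le_of_mul_sq_le {q a g D : ℝ} (hq : 0 < q) (h : q * a ^ 2 ≤ |a| * g + D) :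
    a ^ 2 ≤ (g ^ 2 / q + 2 * D) / q := by
  have h1 : g ^ 2 / q * q = g ^ 2 := div_mul_cancel₀ _ hq.ne'
  have h2 := sq_nonneg (q * |a| - g)
  rw [← sq_abs a] at h ⊢
  rw [le_div_iff₀ hq]
  have h3 : 0 ≤ q * (g ^ 2 / q + 2 * D - |a| ^ 2 * q) := by nlinarith
  linarith [nonneg_of_mul_nonneg_right h3 hq]

-- Induction on the order: all Leibniz terms except `c u^(i)` involve lower orders and go into the
-- bounded right-hand side `G`. Keeping `c u^(i)` on the left provides the damping `γ² a²` in
-- Bernstein's argument. Where the weight is at most `ε`, the bound in powers of `ε` already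
-- suffices.
set_option maxHeartbeats 800000 in
theorem exists_bound_weight_pow_mul_iteratedDeriv {c f : ℝ → ℝ}
    (hc : ContDiffOn ℝ ∞ c (Icc 0 1)) (hf : ContDiffOn ℝ ∞ f (Icc 0 1))
    {γ : ℝ} (hγ : 0 < γ ^ 2) (hcγ : ∀ x ∈ Icc (0 : ℝ) 1, γ ^ 2 ≤ c x) (j : ℕ) :
    ∃ K, 0 ≤ K ∧ ∀ ε : ℝ, 0 < ε → ε < 1 / 2 → ∀ u, IsReactionDiffusionSolution ε c f u →
      ∀ x ∈ Ioo (0 : ℝ) 1, (x * (1 - x)) ^ j * |iteratedDeriv j u x| ≤ K := by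
  choose Bc hBc0 hBc using fun j => hc.exists_bound_iteratedDeriv j
  choose Bf hBf0 hBf using fun j => hf.exists_bound_iteratedDeriv j
  induction j using Nat.strong_induction_on with
  | _ j ih =>
  rcases j with _ | n
  · obtain ⟨K, hK0, hK⟩ := exists_bound_eps_pow_mul_iteratedDeriv hc hf hγ hcγ 0
    exact ⟨K, hK0, fun ε hε hε2 u hu x hx => by simpa using hK ε hε hε2 u hu x hx⟩
  choose! K hK0 hK using ih
  obtain ⟨E, hE0, hE⟩ := exists_bound_eps_pow_mul_iteratedDeriv hc hf hγ hcγ (n + 1)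
  -- the right-hand sides of the differentiated equations
  have hg : ∀ i ≤ n + 1, ∃ g, 0 ≤ g ∧ ∀ ε : ℝ, 0 < ε → ε < 1 / 2 → ∀ u,
      IsReactionDiffusionSolution ε c f u → ∀ x ∈ Ioo (0 : ℝ) 1, ∃ G, |G| ≤ g ∧
      ε ^ 2 * ((x * (1 - x)) ^ i * iteratedDeriv (i + 2) u x)
        = c x * ((x * (1 - x)) ^ i * iteratedDeriv i u x) - G := by
    intro i hi
    refine ⟨∑ m ∈ (Finset.range (i + 1)).erase 0, (i.choose m : ℝ) * Bc m * K (i - m) + Bf i,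
      ?_, ?_⟩
    · refine add_nonneg (Finset.sum_nonneg fun m hm => ?_) (hBf0 i)
      have : m ≠ 0 ∧ m < i + 1 := by simpa using hm
      exact mul_nonneg (mul_nonneg (Nat.cast_nonneg _) (hBc0 m)) (hK0 _ (by omega))
    intro ε hε hε2 u hu x hx
    have heq := hu.iteratedDeriv_equation hε hc hf i hx
    have hd0 := (weight_pos hx).le
    have hd1 := weight_le_one x
    refine ⟨(x * (1 - x)) ^ i * (iteratedDeriv i f x - ∑ m ∈ (Finset.range (i + 1)).erase 0,
      (i.choose m : ℝ) * iteratedDeriv m c x * iteratedDeriv (i - m) u x), ?_, ?_⟩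
    · have h1 := pow_mul_abs_leibniz_le (j := i) (S := (Finset.range (i + 1)).erase 0)
        (C := fun m => iteratedDeriv m c x) (U := fun m => iteratedDeriv m u x) (K := K)
        hd0 hd1 (fun m => hBc m x hx) (fun m hm => by
          have : m ≠ 0 ∧ m < i + 1 := by simpa using hm
          exact hK _ (by omega) ε hε hε2 u hu x hx)
      have h2 : (x * (1 - x)) ^ i * |iteratedDeriv i f x| ≤ Bf i :=
        (mul_le_of_le_one_left (abs_nonneg _) (pow_le_one₀ hd0 hd1)).trans (hBf i x hx)
      rw [abs_mul, abs_of_nonneg (pow_nonneg hd0 i)]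
      refine (mul_le_mul_of_nonneg_left (abs_sub _ _) (pow_nonneg hd0 i)).trans ?_
      rw [mul_add]
      linarith
    · rw [← Finset.add_sum_erase _ _ (Finset.mem_range.2 (Nat.succ_pos i))] at heq
      simp only [Nat.choose_zero_right, Nat.cast_one, one_mul, iteratedDeriv_zero,
        Nat.sub_zero] at heq
      rw [mul_left_comm, heq]
      ring
  obtain ⟨g₁, hg₁, hG₁⟩ := hg (n + 1) le_rfl
  obtain ⟨g₂, hg₂, hG₂⟩ := hg n (Nat.le_succ n)
  set β := K n with hβ
  have hβ0 : 0 ≤ β := hK0 n (Nat.lt_succ_self n)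
  obtain ⟨L, hL⟩ : ∃ L : ℝ, L = 3 * ((n + 1 : ℕ) : ℝ) + 2 * ((n + 1 : ℕ) : ℝ) ^ 2 := ⟨_, rfl⟩
  have hL0 : 0 ≤ L := by rw [hL]; positivity
  set D := 4 * L * ((4 * (n : ℝ) ^ 2 + 3 * n) * β ^ 2 + β * g₂) with hD
  have hD0 : 0 ≤ D := by positivity
  set Q := (g₁ ^ 2 / γ ^ 2 + 2 * D) / γ ^ 2 with hQ
  have hQ0 : 0 ≤ Q := by positivity
  -- At the maximum of `a² + 4 L b²`, `a²` is at most `E²` if the weight equals `ε` and at most `Q`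
  -- otherwise, and `b² ≤ β²` by induction.
  refine ⟨Real.sqrt (E ^ 2 + Q + 4 * L * β ^ 2), Real.sqrt_nonneg _,
    fun ε hε hε2 u hu x hx => ?_⟩
  have hU := hu.contDiffOn_infty hε hc hf
  have hder : ∀ j, ∀ y ∈ Ioo (0 : ℝ) 1,
      HasDerivAt (iteratedDeriv j u) (iteratedDeriv (j + 1) u y) y :=
    fun j y hy => hU.hasDerivAt_iteratedDeriv isOpen_Ioo j hy
  have habs : ∀ y ∈ Ioo (0 : ℝ) 1, |(y * (1 - y)) ^ n * iteratedDeriv n u y| ≤ β := by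
    intro y hy
    rw [abs_mul, abs_of_nonneg (pow_nonneg (weight_pos hy).le n)]
    exact hK n (Nat.lt_succ_self n) ε hε hε2 u hu y hy
  have hsmall : ∀ y ∈ Ioo (0 : ℝ) 1, y * (1 - y) ≤ ε →
      ((y * (1 - y)) ^ (n + 1) * iteratedDeriv (n + 1) u y) ^ 2 ≤ E ^ 2 := by
    intro y hy hyε
    rw [← sq_abs, abs_mul, abs_of_nonneg (pow_nonneg (weight_pos hy).le _)]
    have h0 := (weight_pos hy).le
    have : (y * (1 - y)) ^ (n + 1) * |iteratedDeriv (n + 1) u y| ≤ E :=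
      le_trans (by gcongr) (hE ε hε hε2 u hu y hy)
    gcongr
  suffices h : ((x * (1 - x)) ^ (n + 1) * iteratedDeriv (n + 1) u x) ^ 2
      ≤ E ^ 2 + Q + 4 * L * β ^ 2 by
    rw [← abs_of_nonneg (pow_nonneg (weight_pos hx).le (n + 1)), ← abs_mul]
    exact Real.abs_le_sqrt h
  rcases le_or_gt (x * (1 - x)) ε with hxε | hxε
  · have := hsmall x hx hxε
    have : 0 ≤ 4 * L * β ^ 2 := by positivity
    linarith
  -- the maximum over the set where the weight is at least `ε`
  set a : ℝ → ℝ := fun y => (y * (1 - y)) ^ (n + 1) * iteratedDeriv (n + 1) u y with ha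
  set b : ℝ → ℝ := fun y => (y * (1 - y)) ^ n * iteratedDeriv n u y with hb
  set W : ℝ → ℝ := fun y => a y ^ 2 + 4 * L * b y ^ 2 with hW
  set R : Set ℝ := Icc 0 1 ∩ {y | ε ≤ y * (1 - y)} with hR
  -- The cut-off at `ε > 0` keeps the compact set away from the end points, so interior smoothness
  -- is enough.
  have hRsub : R ⊆ Ioo (0 : ℝ) 1 := by
    rintro y ⟨hy, hyε⟩
    have hyε : ε ≤ y * (1 - y) := hyε
    refine ⟨lt_of_le_of_ne hy.1 ?_, lt_of_le_of_ne hy.2 ?_⟩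
    · rintro rfl; simp at hyε; linarith
    · rintro rfl; simp at hyε; linarith
  have hRc : IsCompact R :=
    isCompact_Icc.inter_right (isClosed_le continuous_const (by fun_prop))
  have hacont : ContinuousOn W R := by
    intro y hy
    have h1 := (hder (n + 1) y (hRsub hy)).continuousAt
    have h2 := (hder n y (hRsub hy)).continuousAt
    exact ContinuousAt.continuousWithinAt (by fun_prop)
  have hxR : x ∈ R := ⟨Ioo_subset_Icc_self hx, hxε.le⟩
  obtain ⟨y, hyR, hmax⟩ := hRc.exists_isMaxOn ⟨x, hxR⟩ hacont
  have hy := hRsub hyR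
  have hWx : W x ≤ W y := hmax hxR
  have hb2 : b y ^ 2 ≤ β ^ 2 := by rw [← sq_abs]; gcongr; exact habs y hy
  have hWxa : a x ^ 2 ≤ W x := by
    have : 0 ≤ 4 * L * b x ^ 2 := by positivity
    simp only [hW]; linarith
  have hWy : W y ≤ a y ^ 2 + 4 * L * β ^ 2 := by
    simp only [hW]; gcongr
  suffices h : a y ^ 2 ≤ E ^ 2 + Q by
    change a x ^ 2 ≤ _
    linarith
  rcases eq_or_lt_of_le (show ε ≤ y * (1 - y) from hyR.2) with hyε | hyε
  · have := hsmall y hy hyε.ge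
    change a y ^ 2 ≤ _ at this
    linarith
  have hloc : IsLocalMax W y := by
    refine hmax.isLocalMax (inter_mem (Icc_mem_nhds hy.1 hy.2) ?_)
    have : Continuous fun y : ℝ => y * (1 - y) := by fun_prop
    filter_upwards [this.continuousAt.eventually_const_lt hyε] with z hz using hz.le
  set a₁ : ℝ → ℝ := fun y => ((n + 1 : ℕ) : ℝ) * ((1 - 2 * y) / (y * (1 - y))) * a y
    + (y * (1 - y)) ^ (n + 1) * iteratedDeriv (n + 2) u y with ha₁
  set b₁ : ℝ → ℝ := fun y => (n : ℝ) * ((1 - 2 * y) / (y * (1 - y))) * b y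
    + (y * (1 - y)) ^ n * iteratedDeriv (n + 1) u y with hb₁
  have hda : ∀ z ∈ Ioo (0 : ℝ) 1, HasDerivAt a (a₁ z) z := fun z hz =>
    hasDerivAt_weight_pow_mul (n + 1) hz (hder (n + 1) z hz)
  have hdb : ∀ z ∈ Ioo (0 : ℝ) 1, HasDerivAt b (b₁ z) z := fun z hz =>
    hasDerivAt_weight_pow_mul n hz (hder n z hz)
  have hda₁ := hasDerivAt_deriv_weight_pow_mul (n + 1) hy (hder (n + 1) y hy) (hder (n + 2) y hy)
  have hdb₁ := hasDerivAt_deriv_weight_pow_mul n hy (hder n y hy) (hder (n + 1) y hy)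
  set a₂ := ((((n + 1 : ℕ) : ℝ) * (-2 / (y * (1 - y)) - ((1 - 2 * y) / (y * (1 - y))) ^ 2)
          - (((n + 1 : ℕ) : ℝ) * ((1 - 2 * y) / (y * (1 - y)))) ^ 2) * a y
        + 2 * (((n + 1 : ℕ) : ℝ) * ((1 - 2 * y) / (y * (1 - y)))) * a₁ y
        + (y * (1 - y)) ^ (n + 1) * iteratedDeriv (n + 3) u y) with ha₂
  set b₂ := (((n : ℝ) * (-2 / (y * (1 - y)) - ((1 - 2 * y) / (y * (1 - y))) ^ 2)
          - ((n : ℝ) * ((1 - 2 * y) / (y * (1 - y)))) ^ 2) * b y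
        + 2 * ((n : ℝ) * ((1 - 2 * y) / (y * (1 - y)))) * b₁ y
        + (y * (1 - y)) ^ n * iteratedDeriv (n + 2) u y) with hb₂
  have hda₁' : HasDerivAt a₁ a₂ y := hda₁
  have hdb₁' : HasDerivAt b₁ b₂ y := hdb₁
  have hW2 : 2 * (a₁ y ^ 2 + a y * a₂ + 4 * L * (b₁ y ^ 2 + b y * b₂)) ≤ 0 := by
    refine hloc.second_deriv_nonpos
      (W' := fun z => 2 * (a z * a₁ z) + 4 * L * (2 * (b z * b₁ z))) ?_ ?_
    · filter_upwards [isOpen_Ioo.mem_nhds hy] with z hz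
      refine (((hda z hz).pow 2).add (((hdb z hz).pow 2).const_mul (4 * L))).congr_deriv ?_
      simp; ring
    · refine ((((hda y hy).mul hda₁').const_mul 2).add
        ((((hdb y hy).mul hdb₁').const_mul 2).const_mul (4 * L))).congr_deriv ?_
      ring
  obtain ⟨G, hGle, hGeq⟩ := hG₁ ε hε hε2 u hu y hy
  obtain ⟨G', hG'le, hG'eq⟩ := hG₂ ε hε hε2 u hu y hy
  have hd := weight_pos hy
  have hd1 := weight_le_one y
  set d := y * (1 - y) with hdef
  set s := (1 - 2 * y) / d with hs
  have hsd : (s * d) ^ 2 ≤ 1 := by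
    rw [hs, div_mul_cancel₀ _ hd.ne']
    rw [sq_le_one_iff_abs_le_one, abs_le]
    constructor <;> linarith only [hy.1, hy.2]
  have hs2 : s ^ 2 ≤ 1 / d ^ 2 := by
    rw [le_div_iff₀ (by positivity), ← mul_pow]; exact hsd
  have hS2 : (ε * s) ^ 2 ≤ (ε / d) ^ 2 := by
    calc (ε * s) ^ 2 = ε ^ 2 * s ^ 2 := by ring
      _ ≤ ε ^ 2 * (1 / d ^ 2) := mul_le_mul_of_nonneg_left hs2 (sq_nonneg ε)
      _ = (ε / d) ^ 2 := by rw [mul_one_div, div_pow]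
  -- The coupling of the two functions: the derivative of `b` contains `a / d`, which provides the
  -- absorbing term.
  have hab : b₁ y = n * s * b y + a y / d := by
    have : d ^ n * iteratedDeriv (n + 1) u y = a y / d := by
      simp only [ha]
      rw [eq_div_iff hd.ne', pow_succ]; ring
    rw [hb₁]
    exact congrArg _ this
  have hfin := bernstein_algebra (n := n) (α := ((n + 1 : ℕ) : ℝ)) (θ := ε / d) (S := ε * s)
    (S' := ε ^ 2 * (-2 / d - s ^ 2)) (a := a y) (A := ε * a₁ y) (A' := ε ^ 2 * a₂)
    (b := b y) (B := ε * b₁ y) (B' := ε ^ 2 * b₂) (c := c y) (G := G) (G' := G') (g₁ := g₁)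
    (g₂ := g₂) (β := β) (K := L) (γ := γ) (Nat.cast_nonneg n) (Nat.cast_nonneg _)
    (by positivity) ((div_le_one hd).2 hyε.le) hS2
    (by
      -- The lower bound `-3 θ²` has two parts: `2 θ²` from the second derivative of the weight,
      -- using `d ≤ 1`, and `θ²` from the squared logarithmic derivative.
      have h1 : ε ^ 2 * (2 / d) ≤ 2 * (ε / d) ^ 2 := by
        have e1 : ε ^ 2 * (2 / d) = 2 * (ε / d) ^ 2 * d := by field_simp
        rw [e1]
        exact mul_le_of_le_one_right (by positivity) hd1
      have h2 : ε ^ 2 * (-2 / d - s ^ 2) = -(ε ^ 2 * (2 / d)) - (ε * s) ^ 2 := by ring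
      rw [h2]; linarith)
    (by rw [← hGeq, ha₂]; ring)
    (by rw [hab]; ring)
    (by rw [← hG'eq, hb₂]; ring)
    hL (hcγ y (Ioo_subset_Icc_self hy)) (habs y hy) hGle hG'le
    (by
      have h1 := mul_le_mul_of_nonneg_left hW2 (by positivity : 0 ≤ ε ^ 2 / 2)
      linarith)
  rw [← hD] at hfin
  have : a y ^ 2 ≤ Q := sq_le_of_mul_sq_le hγ hfin
  have hE2 : 0 ≤ E ^ 2 := sq_nonneg E
  linarith

/-- Derivatives of the solution scale with the distance to the boundary, cut off at `ε`. -/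
theorem exists_bound_iteratedDeriv_solution {c f : ℝ → ℝ}
    (hc : ContDiffOn ℝ ∞ c (Icc 0 1)) (hf : ContDiffOn ℝ ∞ f (Icc 0 1))
    {γ : ℝ} (hγ : 0 < γ ^ 2) (hcγ : ∀ x ∈ Icc (0 : ℝ) 1, γ ^ 2 ≤ c x) (j : ℕ) :
    ∃ K, 0 ≤ K ∧ ∀ ε : ℝ, 0 < ε → ε < 1 / 2 → ∀ u, IsReactionDiffusionSolution ε c f u →
      ∀ x ∈ Ioo (0 : ℝ) 1, max ε (x * (1 - x)) ^ j * |iteratedDeriv j u x| ≤ K := by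
  obtain ⟨K, hK0, hK⟩ := exists_bound_eps_pow_mul_iteratedDeriv hc hf hγ hcγ j
  obtain ⟨K', hK'0, hK'⟩ := exists_bound_weight_pow_mul_iteratedDeriv hc hf hγ hcγ j
  refine ⟨max K K', le_max_of_le_left hK0, fun ε hε hε2 u hu x hx => ?_⟩
  rcases max_choice ε (x * (1 - x)) with h | h <;> rw [h]
  · exact (hK ε hε hε2 u hu x hx).trans (le_max_left _ _)
  · exact (hK' ε hε hε2 u hu x hx).trans (le_max_right _ _)

/-! ### Polynomial approximation on one element -/

theorem Polynomial.exists_derivative_eq (q : Polynomial ℝ) :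
    ∃ P : Polynomial ℝ, P.natDegree ≤ q.natDegree + 1 ∧ P.derivative = q := by
  refine ⟨∑ i ∈ Finset.range (q.natDegree + 1),
    Polynomial.monomial (i + 1) (q.coeff i / (i + 1)), ?_, ?_⟩
  · refine Polynomial.natDegree_sum_le_of_forall_le _ _ fun i hi => ?_
    exact (Polynomial.natDegree_monomial_le _).trans
      (by simpa using Nat.lt_succ_iff.1 (Finset.mem_range.1 hi))
  · conv_rhs => rw [q.as_sum_range]
    rw [Polynomial.derivative_sum]
    refine Finset.sum_congr rfl fun i _ => ?_
    rw [Polynomial.derivative_monomial]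
    have : (i : ℝ) + 1 ≠ 0 := by positivity
    simp [div_mul_cancel₀ _ this]

/-- A polynomial `q` whose derivative is close to that of `v` is close to `v` after a shift. -/
theorem abs_sub_shift_le {a b m K : ℝ} {v : ℝ → ℝ} {q : Polynomial ℝ}
    (hv : ∀ x ∈ Ioo a b, HasDerivAt v (deriv v x) x) (hm : m ∈ Ioo a b)
    (hK : ∀ x ∈ Ioo a b, |deriv v x - q.derivative.eval x| ≤ K) (x : ℝ) (hx : x ∈ Ioo a b) :
    |v x - (q + Polynomial.C (v m - q.eval m)).eval x| ≤ K * (b - a) := by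
  have h := (convex_Ioo a b).norm_image_sub_le_of_norm_hasDerivWithin_le
    (f := fun y => v y - q.eval y) (f' := fun y => deriv v y - q.derivative.eval y) (C := K)
    (fun y hy => ((hv y hy).sub (q.hasDerivAt y)).hasDerivWithinAt) hK hm hx
  have hK0 : 0 ≤ K := (abs_nonneg _).trans (hK x hx)
  have h2 : |x - m| ≤ b - a := by
    rw [abs_le]; constructor <;> linarith [hx.1, hx.2, hm.1, hm.2]
  refine le_trans (le_of_eq ?_) (h.trans (mul_le_mul_of_nonneg_left h2 hK0))
  rw [Real.norm_eq_abs]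
  congr 1
  simp
  ring

/-- Approximate `v'` by induction, integrate the polynomial and fix the constant at the midpoint.
Only interior bounds enter, and the derivative estimate comes for free. -/
theorem exists_polynomial_approx (k : ℕ) {a b M : ℝ} (hab : a < b) (v : ℝ → ℝ)
    (hv : ContDiffOn ℝ ∞ v (Ioo a b))
    (hM : ∀ x ∈ Ioo a b, |iteratedDeriv (k + 1) v x| ≤ M) :
    ∃ p : Polynomial ℝ, p.natDegree ≤ k ∧ ∀ x ∈ Ioo a b,
      |v x - p.eval x| ≤ M * (b - a) ^ (k + 1) ∧
      |deriv v x - p.derivative.eval x| ≤ M * (b - a) ^ k := by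
  have hm : (a + b) / 2 ∈ Ioo a b := ⟨by linarith, by linarith⟩
  have hM0 : 0 ≤ M := (abs_nonneg _).trans (hM _ hm)
  have step : ∀ (q : Polynomial ℝ) (K : ℝ),
      (∀ x ∈ Ioo a b, |deriv v x - q.derivative.eval x| ≤ K) → ∀ x ∈ Ioo a b,
      |v x - (q + Polynomial.C (v ((a + b) / 2) - q.eval ((a + b) / 2))).eval x| ≤ K * (b - a) :=
    fun q K => abs_sub_shift_le (fun x hx => by
      simpa using hv.hasDerivAt_iteratedDeriv isOpen_Ioo 0 hx) hm
  induction k generalizing v with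
  | zero =>
    refine ⟨0 + Polynomial.C (v ((a + b) / 2) - (0 : Polynomial ℝ).eval ((a + b) / 2)), by simp,
      fun x hx => ?_⟩
    have h1 : ∀ y ∈ Ioo a b, |deriv v y - (Polynomial.derivative 0).eval y| ≤ M := fun y hy => by
      simpa using hM y hy
    refine ⟨by simpa using step 0 M h1 x hx, ?_⟩
    simpa using hM x hx
  | succ k ih =>
    have hdv : ContDiffOn ℝ ∞ (deriv v) (Ioo a b) :=
      ((contDiffOn_infty_iff_deriv_of_isOpen isOpen_Ioo).1 hv).2
    obtain ⟨q, hq, hqv⟩ := ih (deriv v) hdv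
      (fun x hx => by rw [← iteratedDeriv_succ']; exact hM x hx)
      (fun q K => abs_sub_shift_le (fun x hx => by
        simpa using hdv.hasDerivAt_iteratedDeriv isOpen_Ioo 0 hx) hm)
    obtain ⟨P, hP, hPq⟩ := q.exists_derivative_eq
    have h1 : ∀ y ∈ Ioo a b, |deriv v y - P.derivative.eval y| ≤ M * (b - a) ^ (k + 1) := by
      intro y hy
      rw [hPq]; exact (hqv y hy).1
    refine ⟨P + Polynomial.C (v ((a + b) / 2) - P.eval ((a + b) / 2)), ?_, fun x hx => ⟨?_, ?_⟩⟩
    · rw [Polynomial.natDegree_add_C]; omega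
    · rw [pow_succ _ (k + 1), ← mul_assoc]
      exact step P _ h1 x hx
    · simpa using h1 x hx

/-- Polynomial approximation that is exact at the end points. -/
theorem exists_polynomial_interpolant {k : ℕ} (hk : 1 ≤ k) {a b M : ℝ} (hab : a < b) {v : ℝ → ℝ}
    (hvc : ContinuousOn v (Icc a b)) (hv : ContDiffOn ℝ ∞ v (Ioo a b))
    (hM : ∀ x ∈ Ioo a b, |iteratedDeriv (k + 1) v x| ≤ M) :
    ∃ p : Polynomial ℝ, p.natDegree ≤ k ∧ p.eval a = v a ∧ p.eval b = v b ∧ ∀ x ∈ Ioo a b,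
      |v x - p.eval x| ≤ 2 * M * (b - a) ^ (k + 1) ∧
      |deriv v x - p.derivative.eval x| ≤ 3 * M * (b - a) ^ k := by
  obtain ⟨p, hp, hpv⟩ := exists_polynomial_approx k hab v hv hM
  set T := M * (b - a) ^ (k + 1) with hT
  have hcl : ∀ x ∈ Icc a b, |v x - p.eval x| ≤ T := by
    intro x hx
    rw [← closure_Ioo hab.ne] at hx hvc
    exact le_on_closure (f := fun x => |v x - p.eval x|) (g := fun _ => T)
      (fun y hy => (hpv y hy).1) (hvc.sub p.continuous.continuousOn).abs continuousOn_const hx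
  have hba : 0 < b - a := sub_pos.2 hab
  set α := v a - p.eval a with hα
  set β := v b - p.eval b with hβ
  have hα' : |α| ≤ T := hcl a (left_mem_Icc.2 hab.le)
  have hβ' : |β| ≤ T := hcl b (right_mem_Icc.2 hab.le)
  -- Adding the linear interpolant of the end point errors makes `p` exact there; this needs `1 ≤
  -- k`. The correction is at most `T` in value and `2 T / (b - a)` in slope, hence the constants
  -- `2` and `3`.
  set s := (β - α) / (b - a) with hs
  have hsb : s * (b - a) = β - α := div_mul_cancel₀ _ hba.ne'
  have hs' : |s| ≤ 2 * M * (b - a) ^ k := by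
    rw [hs, abs_div, abs_of_pos hba, div_le_iff₀ hba]
    calc |β - α| ≤ |β| + |α| := abs_sub _ _
      _ ≤ 2 * T := by linarith
      _ = 2 * M * (b - a) ^ k * (b - a) := by rw [hT]; ring
  refine ⟨p + (Polynomial.C s * Polynomial.X + Polynomial.C (α - s * a)), ?_, ?_, ?_,
    fun x hx => ⟨?_, ?_⟩⟩
  · refine (Polynomial.natDegree_add_le _ _).trans (max_le hp ?_)
    exact (Polynomial.natDegree_linear_le).trans hk
  · simp [hα]
  · simp only [Polynomial.eval_add, Polynomial.eval_mul, Polynomial.eval_C, Polynomial.eval_X]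
    linarith
  · have h1 := (hpv x hx).1
    simp only [Polynomial.eval_add, Polynomial.eval_mul, Polynomial.eval_C, Polynomial.eval_X]
    have h2 : |s * x + (α - s * a)| ≤ T := by
      have e : s * x + (α - s * a) = ((b - x) * α + (x - a) * β) / (b - a) := by
        rw [eq_div_iff hba.ne']; linear_combination (x - a) * hsb
      have h3 : 0 ≤ b - x := by linarith [hx.2]
      have h4 : 0 ≤ x - a := by linarith [hx.1]
      rw [e, abs_div, abs_of_pos hba, div_le_iff₀ hba]
      calc |(b - x) * α + (x - a) * β| ≤ |(b - x) * α| + |(x - a) * β| := abs_add_le _ _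
        _ = (b - x) * |α| + (x - a) * |β| := by
          rw [abs_mul, abs_mul, abs_of_nonneg h3, abs_of_nonneg h4]
        _ ≤ (b - x) * T + (x - a) * T := by gcongr
        _ = T * (b - a) := by ring
    have h5 := abs_sub (v x - p.eval x) (s * x + (α - s * a))
    rw [sub_sub] at h5
    rw [mul_assoc]
    linarith
  · have h1 := (hpv x hx).2
    have h5 := abs_sub (deriv v x - p.derivative.eval x) s
    rw [sub_sub] at h5
    have : (Polynomial.derivative
        (p + (Polynomial.C s * Polynomial.X + Polynomial.C (α - s * a)))).eval x
        = p.derivative.eval x + s := by simp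
    rw [this]
    linarith

/-! ### Regularity up to the boundary -/

/-- The solution extends to a continuously differentiable function on the line. -/
theorem IsReactionDiffusionSolution.exists_contDiff_extension {ε : ℝ} {c f u : ℝ → ℝ}
    (hu : IsReactionDiffusionSolution ε c f u) (hε : 0 < ε)
    (hc : ContDiffOn ℝ ∞ c (Icc 0 1)) (hf : ContDiffOn ℝ ∞ f (Icc 0 1)) :
    ∃ g : ℝ → ℝ, ContDiff ℝ 1 g ∧ EqOn u g (Icc 0 1) := by
  have hU := hu.contDiffOn_infty hε hc hf
  have hd : ∀ j, ∀ y ∈ Ioo (0 : ℝ) 1,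
      HasDerivAt (iteratedDeriv j u) (iteratedDeriv (j + 1) u y) y :=
    fun j y hy => hU.hasDerivAt_iteratedDeriv isOpen_Ioo j hy
  have hz : ContinuousOn (fun x => (c x * u x - f x) / ε ^ 2) (Icc 0 1) :=
    ((hc.continuousOn.mul hu.continuousOn).sub hf.continuousOn).div_const _
  obtain ⟨B, hB⟩ := isCompact_Icc.exists_bound_of_continuousOn hz
  -- The equation bounds `u''` because `u` is continuous on `[0, 1]`. Thus `u'` is Lipschitz,
  -- extends to the line, and the extension is integrated; this gives meaning to the boundary values
  -- of `u'` in the form.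
  have hlip : LipschitzOnWith B.toNNReal (deriv u) (Ioo 0 1) := by
    refine LipschitzOnWith.of_dist_le_mul fun x hx y hy => ?_
    rw [dist_eq_norm, dist_eq_norm]
    have hB0 : 0 ≤ B := (norm_nonneg _).trans (hB x (Ioo_subset_Icc_self hx))
    rw [Real.coe_toNNReal _ hB0]
    refine (convex_Ioo (0 : ℝ) 1).norm_image_sub_le_of_norm_hasDerivWithin_le
      (f' := deriv (deriv u)) (fun z hz => ?_) (fun z hz => ?_) hy hx
    · have := hd 1 z hz
      simp only [iteratedDeriv_succ, iteratedDeriv_zero] at this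
      exact this.hasDerivWithinAt
    · rw [hu.deriv_deriv_eq hε hz]
      exact hB z (Ioo_subset_Icc_self hz)
  obtain ⟨D, hDlip, hD⟩ := hlip.extend_real
  have hDc := hDlip.continuous
  set g : ℝ → ℝ := fun x => u (1 / 2) + ∫ t in (1 / 2 : ℝ)..x, D t with hg
  have hgd : ∀ x, HasDerivAt g (D x) x := fun x =>
    (intervalIntegral.integral_hasDerivAt_right (hDc.intervalIntegrable _ _)
      hDc.stronglyMeasurable.stronglyMeasurableAtFilter hDc.continuousAt).const_add _
  have hgc : Continuous g := continuous_iff_continuousAt.2 fun x => (hgd x).continuousAt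
  refine ⟨g, ?_, ?_⟩
  · rw [contDiff_one_iff_deriv]
    refine ⟨fun x => (hgd x).differentiableAt, ?_⟩
    rwa [show deriv g = D from funext fun x => (hgd x).deriv]
  · have hIoo : EqOn u g (Ioo 0 1) := by
      intro x hx
      have h12 : (1 / 2 : ℝ) ∈ Ioo (0 : ℝ) 1 := by norm_num
      have h := (convex_Ioo (0 : ℝ) 1).norm_image_sub_le_of_norm_hasDerivWithin_le
        (f := fun y => u y - g y) (f' := fun _ => 0) (C := 0) (fun y hy => by
          have h1 := hd 0 y hy
          simp only [iteratedDeriv_succ, iteratedDeriv_zero, zero_add] at h1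
          have := (h1.sub (hgd y))
          rw [hD hy, sub_self] at this
          exact this.hasDerivWithinAt) (by simp) h12 hx
      have h2 : u (1 / 2) - g (1 / 2) = 0 := by simp [hg]
      simp only [h2, sub_zero, zero_mul, norm_le_zero_iff] at h
      linarith
    exact hIoo.of_subset_closure hu.continuousOn hgc.continuousOn Ioo_subset_Icc_self
      (closure_Ioo zero_ne_one).ge

/-! ### One-sided limits, broken functions and the bilinear form -/

theorem rightLim_eq_of_eqOn {a b : ℝ} (hab : a < b) {w φ : ℝ → ℝ} (hφ : Continuous φ)
    (h : EqOn w φ (Ioo a b)) : Function.rightLim w a = φ a := by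
  refine rightLim_eq_of_tendsto ?_
  refine ((hφ.tendsto a).mono_left nhdsWithin_le_nhds).congr' ?_
  filter_upwards [Ioo_mem_nhdsGT hab] with t ht using (h ht).symm

theorem leftLim_eq_of_eqOn {a b : ℝ} (hab : a < b) {w φ : ℝ → ℝ} (hφ : Continuous φ)
    (h : EqOn w φ (Ioo a b)) : Function.leftLim w b = φ b := by
  refine leftLim_eq_of_tendsto ?_
  refine ((hφ.tendsto b).mono_left nhdsWithin_le_nhds).congr' ?_
  filter_upwards [Ioo_mem_nhdsLT hab] with t ht using (h ht).symm

theorem intervalIntegrable_of_eqOn_Ioo {a b : ℝ} (hab : a ≤ b) {w φ : ℝ → ℝ}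
    (hφ : ContinuousOn φ (Icc a b)) (h : EqOn w φ (Ioo a b)) :
    IntervalIntegrable w volume a b := by
  rw [intervalIntegrable_iff_integrableOn_Ioo_of_le hab]
  exact (hφ.integrableOn_Icc.mono_set Ioo_subset_Icc_self).congr_fun h.symm measurableSet_Ioo

theorem integral_congr_of_eqOn_Ioo {a b : ℝ} (hab : a ≤ b) {w φ : ℝ → ℝ}
    (h : EqOn w φ (Ioo a b)) : ∫ t in a..b, w t = ∫ t in a..b, φ t := by
  rw [intervalIntegral.integral_of_le hab, intervalIntegral.integral_of_le hab,
    integral_Ioc_eq_integral_Ioo, integral_Ioc_eq_integral_Ioo]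
  exact setIntegral_congr_fun measurableSet_Ioo h

theorem integral_mono_of_le_on_Ioo {a b : ℝ} (hab : a ≤ b) {w φ : ℝ → ℝ}
    (hw : IntervalIntegrable w volume a b) (hφ : IntervalIntegrable φ volume a b)
    (h : ∀ t ∈ Ioo a b, w t ≤ φ t) : ∫ t in a..b, w t ≤ ∫ t in a..b, φ t := by
  rw [intervalIntegrable_iff_integrableOn_Ioo_of_le hab] at hw hφ
  rw [intervalIntegral.integral_of_le hab, intervalIntegral.integral_of_le hab,
    integral_Ioc_eq_integral_Ioo, integral_Ioc_eq_integral_Ioo]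
  exact setIntegral_mono_on hw hφ measurableSet_Ioo h

/-- On every open element `w` agrees with the continuously differentiable function `g i`. -/
def IsBrokenC1 (N : ℕ) (x : ℕ → ℝ) (g : ℕ → ℝ → ℝ) (w : ℝ → ℝ) : Prop :=
  ∀ i < N, ContDiff ℝ 1 (g i) ∧ EqOn w (g i) (Ioo (x i) (x (i + 1)))

namespace IsBrokenC1

variable {N : ℕ} {x : ℕ → ℝ} {g h : ℕ → ℝ → ℝ} {w v : ℝ → ℝ}

theorem eqOn_deriv (hw : IsBrokenC1 N x g w) {i : ℕ} (hi : i < N) :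
    EqOn (deriv w) (deriv (g i)) (Ioo (x i) (x (i + 1))) := by
  intro t ht
  refine EventuallyEq.deriv_eq ?_
  filter_upwards [isOpen_Ioo.mem_nhds ht] with s hs using (hw i hi).2 hs

theorem differentiableAt (hw : IsBrokenC1 N x g w) {i : ℕ} (hi : i < N) {t : ℝ}
    (ht : t ∈ Ioo (x i) (x (i + 1))) : DifferentiableAt ℝ w t := by
  have h1 : DifferentiableAt ℝ (g i) t := (hw i hi).1.differentiable one_ne_zero t
  refine h1.congr_of_eventuallyEq ?_
  filter_upwards [isOpen_Ioo.mem_nhds ht] with s hs using (hw i hi).2 hs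

theorem continuous (hw : IsBrokenC1 N x g w) {i : ℕ} (hi : i < N) : Continuous (g i) :=
  (hw i hi).1.continuous

theorem continuous_deriv (hw : IsBrokenC1 N x g w) {i : ℕ} (hi : i < N) :
    Continuous (deriv (g i)) :=
  (hw i hi).1.continuous_deriv le_rfl

theorem sub (hw : IsBrokenC1 N x g w) (hv : IsBrokenC1 N x h v) :
    IsBrokenC1 N x (g - h) (w - v) := fun i hi =>
  ⟨(hw i hi).1.sub (hv i hi).1, fun t ht => by
    simp only [Pi.sub_apply, (hw i hi).2 ht, (hv i hi).2 ht]⟩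

theorem rightLim_eq (hx : ∀ i < N, x i < x (i + 1))
    (hw : IsBrokenC1 N x g w) {i : ℕ} (hi : i < N) :
    Function.rightLim w (x i) = g i (x i) :=
  rightLim_eq_of_eqOn (hx i hi) (hw.continuous hi) (hw i hi).2

theorem leftLim_eq (hx : ∀ i < N, x i < x (i + 1))
    (hw : IsBrokenC1 N x g w) {i : ℕ} (hi : i < N) :
    Function.leftLim w (x (i + 1)) = g i (x (i + 1)) :=
  leftLim_eq_of_eqOn (hx i hi) (hw.continuous hi) (hw i hi).2

theorem rightLim_deriv_eq (hx : ∀ i < N, x i < x (i + 1))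
    (hw : IsBrokenC1 N x g w) {i : ℕ} (hi : i < N) :
    Function.rightLim (deriv w) (x i) = deriv (g i) (x i) :=
  rightLim_eq_of_eqOn (hx i hi) (hw.continuous_deriv hi) (hw.eqOn_deriv hi)

theorem leftLim_deriv_eq (hx : ∀ i < N, x i < x (i + 1))
    (hw : IsBrokenC1 N x g w) {i : ℕ} (hi : i < N) :
    Function.leftLim (deriv w) (x (i + 1)) = deriv (g i) (x (i + 1)) :=
  leftLim_eq_of_eqOn (hx i hi) (hw.continuous_deriv hi) (hw.eqOn_deriv hi)

/-- With the function set to zero outside the mesh, end nodes and interior nodes obey one formula,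
which suits summation by parts. -/
theorem nodeJump_eq (hx : ∀ i < N, x i < x (i + 1))
    (hw : IsBrokenC1 N x g w) {i : ℕ} (hN : 0 < N) (hi : i ≤ N) :
    nodeJump N x w i =
      (if i < N then g i (x i) else 0) - (if 0 < i then g (i - 1) (x i) else 0) := by
  unfold nodeJump
  rcases Nat.eq_zero_or_pos i with rfl | h0
  · simp [hN, hw.rightLim_eq hx hN]
  obtain ⟨j, rfl⟩ : ∃ j, i = j + 1 := ⟨i - 1, by omega⟩
  have hl := hw.leftLim_eq hx (show j < N by omega)
  rcases eq_or_lt_of_le hi with rfl | h1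
  · simp [hl]
  · have hr := hw.rightLim_eq hx h1
    simp [hl, hr, h1, h1.ne]

theorem nodeAverage_deriv_eq (hx : ∀ i < N, x i < x (i + 1))
    (hw : IsBrokenC1 N x g w) {i : ℕ} (hN : 0 < N) (hi : i ≤ N) :
    nodeAverage N x (deriv w) i =
      if i = 0 then deriv (g 0) (x 0) else if i = N then deriv (g (i - 1)) (x i)
      else (deriv (g i) (x i) + deriv (g (i - 1)) (x i)) / 2 := by
  unfold nodeAverage
  rcases Nat.eq_zero_or_pos i with rfl | h0
  · simp [hw.rightLim_deriv_eq hx hN]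
  obtain ⟨j, rfl⟩ : ∃ j, i = j + 1 := ⟨i - 1, by omega⟩
  have hl := hw.leftLim_deriv_eq hx (show j < N by omega)
  rcases eq_or_lt_of_le hi with rfl | h1
  · simp [hl]
  · have hr := hw.rightLim_deriv_eq hx h1
    simp [hl, hr, h1.ne]

theorem nodeJump_sub (hx : ∀ i < N, x i < x (i + 1))
    (hw : IsBrokenC1 N x g w) (hv : IsBrokenC1 N x h v) {i : ℕ} (hN : 0 < N)
    (hi : i ≤ N) : nodeJump N x (w - v) i = nodeJump N x w i - nodeJump N x v i := by
  rw [(hw.sub hv).nodeJump_eq hx hN hi, hw.nodeJump_eq hx hN hi, hv.nodeJump_eq hx hN hi]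
  simp only [Pi.sub_apply]
  split_ifs <;> ring

theorem nodeAverage_deriv_sub (hx : ∀ i < N, x i < x (i + 1))
    (hw : IsBrokenC1 N x g w) (hv : IsBrokenC1 N x h v) {i : ℕ}
    (hN : 0 < N) (hi : i ≤ N) : nodeAverage N x (deriv (w - v)) i
      = nodeAverage N x (deriv w) i - nodeAverage N x (deriv v) i := by
  rw [(hw.sub hv).nodeAverage_deriv_eq hx hN hi, hw.nodeAverage_deriv_eq hx hN hi,
    hv.nodeAverage_deriv_eq hx hN hi]
  have hd : ∀ j < N, ∀ t, deriv ((g - h) j) t = deriv (g j) t - deriv (h j) t := fun j hj t =>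
    deriv_sub ((hw j hj).1.differentiable one_ne_zero t)
      ((hv j hj).1.differentiable one_ne_zero t)
  split_ifs with h1 h2
  · exact hd 0 hN _
  · exact hd _ (by omega) _
  · rw [hd _ (by omega), hd _ (by omega)]; ring

/-- The jump at an end node is a signed trace, so `φ` has to vanish there too. This serves both the
solution and the interpolation error. -/
theorem nodeJump_eq_zero (hx : ∀ i < N, x i < x (i + 1))
    (hw : IsBrokenC1 N x g w) {φ : ℕ → ℝ}
    (htr : ∀ i < N, g i (x i) = φ i ∧ g i (x (i + 1)) = φ (i + 1)) (h0 : φ 0 = 0) (h1 : φ N = 0)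
    {i : ℕ} (hN : 0 < N) (hi : i ≤ N) : nodeJump N x w i = 0 := by
  rw [hw.nodeJump_eq hx hN hi]
  rcases Nat.eq_zero_or_pos i with rfl | hi0
  · simp [hN, (htr 0 hN).1, h0]
  obtain ⟨j, rfl⟩ : ∃ j, i = j + 1 := ⟨i - 1, by omega⟩
  have hl := (htr j (by omega)).2
  rcases eq_or_lt_of_le hi with rfl | hlt
  · simp [hl, h1]
  · simp [hl, (htr _ hlt).1, hlt]

/-- Bounds on the open elements pass to the one-sided limits because each piece has a continuous
derivative. -/
theorem abs_nodeAverage_deriv_le (hx : ∀ i < N, x i < x (i + 1))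
    (hw : IsBrokenC1 N x g w) {T : ℝ}
    (hT : ∀ i < N, ∀ t ∈ Ioo (x i) (x (i + 1)), |deriv w t| ≤ T)
    {i : ℕ} (hN : 0 < N) (hi : i ≤ N) : |nodeAverage N x (deriv w) i| ≤ T := by
  have hcl : ∀ j < N, ∀ t ∈ Icc (x j) (x (j + 1)), |deriv (g j) t| ≤ T := by
    intro j hj t ht
    rw [← closure_Ioo (hx j hj).ne] at ht
    refine le_on_closure (f := fun t => |deriv (g j) t|) (g := fun _ => T) (fun s hs => ?_)
      (hw.continuous_deriv hj).abs.continuousOn continuousOn_const ht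
    rw [← hw.eqOn_deriv hj hs]
    exact hT j hj s hs
  have hr : ∀ j < N, |deriv (g j) (x j)| ≤ T := fun j hj =>
    hcl j hj _ (left_mem_Icc.2 (hx j hj).le)
  have hl : ∀ j < N, |deriv (g j) (x (j + 1))| ≤ T := fun j hj =>
    hcl j hj _ (right_mem_Icc.2 (hx j hj).le)
  rw [hw.nodeAverage_deriv_eq hx hN hi]
  rcases Nat.eq_zero_or_pos i with rfl | hi0
  · simpa using hr 0 hN
  obtain ⟨j, rfl⟩ : ∃ j, i = j + 1 := ⟨i - 1, by omega⟩
  rcases eq_or_lt_of_le hi with rfl | hlt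
  · simpa using hl j (by omega)
  · have h1 := hr _ hlt
    have h2 := hl j (by omega)
    simp only [Nat.add_eq_zero_iff, one_ne_zero, and_false, if_false, hlt.ne, Nat.add_sub_cancel]
    rw [abs_le] at *
    constructor <;> linarith [h1.1, h1.2, h2.1, h2.2]

variable {ε : ℝ} {c : ℝ → ℝ}

theorem intervalIntegrable_mul (hx : ∀ i < N, x i < x (i + 1))
    (hw : IsBrokenC1 N x g w) (hc : ∀ i < N, ContinuousOn c
    (Icc (x i) (x (i + 1)))) {i : ℕ} (hi : i < N) :
    IntervalIntegrable (fun t => c t * w t) volume (x i) (x (i + 1)) := by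
  refine intervalIntegrable_of_eqOn_Ioo (φ := fun t => c t * g i t) (hx i hi).le
    ((hc i hi).mul (hw.continuous hi).continuousOn) fun t ht => ?_
  simp only [(hw i hi).2 ht]

theorem intervalIntegrable_form (hx : ∀ i < N, x i < x (i + 1))
    (hw : IsBrokenC1 N x g w) (hv : IsBrokenC1 N x h v)
    (hc : ∀ i < N, ContinuousOn c (Icc (x i) (x (i + 1)))) {i : ℕ} (hi : i < N) :
    IntervalIntegrable (fun t => ε ^ 2 * deriv w t * deriv v t + c t * w t * v t) volume
      (x i) (x (i + 1)) := by
  refine intervalIntegrable_of_eqOn_Ioo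
    (φ := fun t => ε ^ 2 * deriv (g i) t * deriv (h i) t + c t * g i t * h i t) (hx i hi).le ?_ ?_
  · have := hw.continuous hi
    have := hv.continuous hi
    have := hw.continuous_deriv hi
    have := hv.continuous_deriv hi
    have := hc i hi
    fun_prop
  · intro t ht
    simp only [(hw i hi).2 ht, (hv i hi).2 ht, hw.eqOn_deriv hi ht, hv.eqOn_deriv hi ht]

theorem galerkinForm_sub_left (hx : ∀ i < N, x i < x (i + 1))
    {g' : ℕ → ℝ → ℝ} {w' : ℝ → ℝ} (hw : IsBrokenC1 N x g w)
    (hw' : IsBrokenC1 N x g' w') (hv : IsBrokenC1 N x h v)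
    (hc : ∀ i < N, ContinuousOn c (Icc (x i) (x (i + 1)))) :
    galerkinForm ε c N x (w - w') v = galerkinForm ε c N x w v - galerkinForm ε c N x w' v := by
  unfold galerkinForm
  rw [← Finset.sum_sub_distrib]
  refine Finset.sum_congr rfl fun i hi => ?_
  have hi := Finset.mem_range.1 hi
  rw [← intervalIntegral.integral_sub (hw.intervalIntegrable_form hx hv hc hi)
    (hw'.intervalIntegrable_form hx hv hc hi)]
  refine integral_congr_of_eqOn_Ioo (hx i hi).le fun t ht => ?_
  have : deriv (w - w') t = deriv w t - deriv w' t :=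
    deriv_sub (hw.differentiableAt hi ht) (hw'.differentiableAt hi ht)
  simp only [this, Pi.sub_apply]
  ring

theorem galerkinForm_comm (w v : ℝ → ℝ) :
    galerkinForm ε c N x w v = galerkinForm ε c N x v w := by
  unfold galerkinForm
  simp only [mul_right_comm]

theorem nipgForm_sub_left (hx : ∀ i < N, x i < x (i + 1))
    {σ : ℕ → ℝ} {g' : ℕ → ℝ → ℝ} {w' : ℝ → ℝ} (hN : 0 < N)
    (hw : IsBrokenC1 N x g w) (hw' : IsBrokenC1 N x g' w') (hv : IsBrokenC1 N x h v)
    (hc : ∀ i < N, ContinuousOn c (Icc (x i) (x (i + 1)))) :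
    nipgForm ε c N x σ (w - w') v = nipgForm ε c N x σ w v - nipgForm ε c N x σ w' v := by
  unfold nipgForm
  rw [hw.galerkinForm_sub_left hx hw' hv hc, add_sub_add_comm, ← Finset.sum_sub_distrib]
  congr 1
  refine Finset.sum_congr rfl fun i hi => ?_
  have hi : i ≤ N := Nat.lt_succ_iff.1 (Finset.mem_range.1 hi)
  rw [hw.nodeJump_sub hx hw' hN hi, hw.nodeAverage_deriv_sub hx hw' hN hi]
  ring

theorem nipgForm_sub_right (hx : ∀ i < N, x i < x (i + 1))
    {σ : ℕ → ℝ} {g' : ℕ → ℝ → ℝ} {w' : ℝ → ℝ} (hN : 0 < N)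
    (hw : IsBrokenC1 N x g w) (hw' : IsBrokenC1 N x g' w') (hv : IsBrokenC1 N x h v)
    (hc : ∀ i < N, ContinuousOn c (Icc (x i) (x (i + 1)))) :
    nipgForm ε c N x σ v (w - w') = nipgForm ε c N x σ v w - nipgForm ε c N x σ v w' := by
  unfold nipgForm
  rw [galerkinForm_comm, hw.galerkinForm_sub_left hx hw' hv hc, galerkinForm_comm w,
    galerkinForm_comm w', add_sub_add_comm, ← Finset.sum_sub_distrib]
  congr 1
  refine Finset.sum_congr rfl fun i hi => ?_
  have hi : i ≤ N := Nat.lt_succ_iff.1 (Finset.mem_range.1 hi)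
  rw [hw.nodeJump_sub hx hw' hN hi, hw.nodeAverage_deriv_sub hx hw' hN hi]
  ring

/-- The integrand of the form at `(w - v, w - v)` is nonnegative; expand it. -/
theorem two_mul_galerkinForm_le (hx : ∀ i < N, x i < x (i + 1))
    (hw : IsBrokenC1 N x g w) (hv : IsBrokenC1 N x h v)
    (hc : ∀ i < N, ContinuousOn c (Icc (x i) (x (i + 1))))
    (hc0 : ∀ i < N, ∀ t ∈ Ioo (x i) (x (i + 1)), 0 ≤ c t) :
    2 * galerkinForm ε c N x w v ≤ galerkinForm ε c N x w w + galerkinForm ε c N x v v := by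
  unfold galerkinForm
  rw [Finset.mul_sum, ← Finset.sum_add_distrib]
  refine Finset.sum_le_sum fun i hi => ?_
  have hi := Finset.mem_range.1 hi
  rw [← intervalIntegral.integral_const_mul, ← intervalIntegral.integral_add
    (hw.intervalIntegrable_form hx hw hc hi) (hv.intervalIntegrable_form hx hv hc hi)]
  refine integral_mono_of_le_on_Ioo (hx i hi).le
    ((hw.intervalIntegrable_form hx hv hc hi).const_mul 2)
    ((hw.intervalIntegrable_form hx hw hc hi).add (hv.intervalIntegrable_form hx hv hc hi))
    fun t ht => ?_
  have h1 : 0 ≤ ε ^ 2 * (deriv w t - deriv v t) ^ 2 := by positivity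
  have h2 : 0 ≤ c t * (w t - v t) ^ 2 := mul_nonneg (hc0 i hi t ht) (sq_nonneg _)
  linarith

theorem galerkinForm_self_le (hx : ∀ i < N, x i < x (i + 1))
    (hw : IsBrokenC1 N x g w)
    (hc : ∀ i < N, ContinuousOn c (Icc (x i) (x (i + 1)))) {B S : ℝ} {T : ℕ → ℝ}
    (hB : 0 ≤ B) (hcB : ∀ i < N, ∀ t ∈ Ioo (x i) (x (i + 1)), c t ≤ B)
    (hS : ∀ i < N, ∀ t ∈ Ioo (x i) (x (i + 1)), |w t| ≤ S)
    (hT : ∀ i < N, ∀ t ∈ Ioo (x i) (x (i + 1)), |deriv w t| ≤ T i) :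
    galerkinForm ε c N x w w ≤
      ∑ i ∈ Finset.range N, (x (i + 1) - x i) * (ε ^ 2 * T i ^ 2 + B * S ^ 2) := by
  unfold galerkinForm
  refine Finset.sum_le_sum fun i hi => ?_
  have hi := Finset.mem_range.1 hi
  have hconst : ∫ _ in (x i)..(x (i + 1)), (ε ^ 2 * T i ^ 2 + B * S ^ 2)
      = (x (i + 1) - x i) * (ε ^ 2 * T i ^ 2 + B * S ^ 2) := by
    rw [intervalIntegral.integral_const, smul_eq_mul]
  rw [← hconst]
  refine integral_mono_of_le_on_Ioo (hx i hi).le (hw.intervalIntegrable_form hx hw hc hi)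
    intervalIntegrable_const fun t ht => ?_
  have h1 : w t ^ 2 ≤ S ^ 2 := by rw [← sq_abs]; gcongr; exact hS i hi t ht
  have h2 : deriv w t ^ 2 ≤ T i ^ 2 := by rw [← sq_abs]; gcongr; exact hT i hi t ht
  have h3 := hcB i hi t ht
  calc ε ^ 2 * deriv w t * deriv w t + c t * w t * w t
      = ε ^ 2 * deriv w t ^ 2 + c t * w t ^ 2 := by ring
    _ ≤ ε ^ 2 * T i ^ 2 + B * w t ^ 2 := by gcongr
    _ ≤ _ := by gcongr

end IsBrokenC1

/-! ### The discrete space, consistency and the abstract error bound -/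

theorem exists_isBrokenC1_of_mem_dGSpace {k N : ℕ} {x : ℕ → ℝ} {v : ℝ → ℝ}
    (hv : v ∈ dGSpace k N x) : ∃ p : ℕ → Polynomial ℝ, IsBrokenC1 N x (fun i => (p i).eval) v := by
  choose! p _ hpv using hv
  exact ⟨p, fun i hi => ⟨by simpa using (p i).contDiff_aeval (𝕜 := ℝ) 1, fun t ht => hpv i hi t ht⟩⟩

theorem sub_mem_dGSpace {k N : ℕ} {x : ℕ → ℝ} {v w : ℝ → ℝ}
    (hv : v ∈ dGSpace k N x) (hw : w ∈ dGSpace k N x) : v - w ∈ dGSpace k N x := by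
  intro i hi
  obtain ⟨p, hp, hpv⟩ := hv i hi
  obtain ⟨q, hq, hqw⟩ := hw i hi
  refine ⟨p - q, (Polynomial.natDegree_sub_le _ _).trans (max_le hp hq), fun t ht => ?_⟩
  simp [hpv t ht, hqw t ht]

theorem le_of_forall_lt_succ {N : ℕ} {x : ℕ → ℝ} (hx : ∀ i < N, x i < x (i + 1)) {i j : ℕ}
    (hij : i ≤ j) (hj : j ≤ N) : x i ≤ x j := by
  induction j, hij using Nat.le_induction with
  | base => exact le_rfl
  | succ j _ ih => exact (ih (by omega)).trans (hx j (by omega)).le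

/-- Functions given on the elements can be glued. -/
theorem exists_glue {N : ℕ} {x : ℕ → ℝ} (hx : ∀ i < N, x i < x (i + 1)) (g : ℕ → ℝ → ℝ) :
    ∃ w : ℝ → ℝ, ∀ i < N, EqOn w (g i) (Ioo (x i) (x (i + 1))) := by
  classical
  refine ⟨fun t => if h : ∃ i, i < N ∧ t ∈ Ioo (x i) (x (i + 1)) then g h.choose t else 0,
    fun i hi t ht => ?_⟩
  have h : ∃ i, i < N ∧ t ∈ Ioo (x i) (x (i + 1)) := ⟨i, hi, ht⟩
  have huniq : ∀ a b, a < N → b < N → t ∈ Ioo (x a) (x (a + 1)) → t ∈ Ioo (x b) (x (b + 1)) →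
      ¬ a < b := by
    intro a b _ hb hta htb hab
    have := le_of_forall_lt_succ hx (show a + 1 ≤ b from hab) hb.le
    linarith [hta.2, htb.1]
  obtain ⟨h1, h2⟩ := h.choose_spec
  have : h.choose = i :=
    le_antisymm (not_lt.1 (huniq _ _ hi h1 ht h2)) (not_lt.1 (huniq _ _ h1 hi h2 ht))
  simp only [dif_pos h, this]

/-- Summation by parts for nodal values `D` against the jumps of `R`, `L`. -/
theorem sum_mul_jump_eq {N : ℕ} (D R L : ℕ → ℝ) :
    ∑ i ∈ Finset.range (N + 1), D i * ((if i < N then R i else 0) - (if 0 < i then L i else 0))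
      = ∑ i ∈ Finset.range N, (D i * R i - D (i + 1) * L (i + 1)) := by
  simp only [mul_sub, Finset.sum_sub_distrib]
  congr 1
  · rw [Finset.sum_range_succ]
    simp only [lt_irrefl, if_false, mul_zero, add_zero]
    exact Finset.sum_congr rfl fun i hi => by rw [if_pos (Finset.mem_range.1 hi)]
  · rw [Finset.sum_range_succ']
    simp

section

variable {ε : ℝ} {c f u : ℝ → ℝ} {k N : ℕ} {x σ : ℕ → ℝ}

theorem mem_Ioo_of_mem_element (hx : ∀ i < N, x i < x (i + 1)) (hx0 : x 0 = 0) (hxN : x N = 1)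
    {i : ℕ} (hi : i < N) {t : ℝ} (ht : t ∈ Ioo (x i) (x (i + 1))) : t ∈ Ioo (0 : ℝ) 1 := by
  have h1 := le_of_forall_lt_succ hx (Nat.zero_le i) hi.le
  have h2 := le_of_forall_lt_succ hx (show i + 1 ≤ N from hi) le_rfl
  exact ⟨by linarith [ht.1], by linarith [ht.2]⟩

theorem element_subset_Icc (hx : ∀ i < N, x i < x (i + 1)) (hx0 : x 0 = 0) (hxN : x N = 1)
    {i : ℕ} (hi : i < N) : Icc (x i) (x (i + 1)) ⊆ Icc 0 1 := by
  have h1 := le_of_forall_lt_succ hx (Nat.zero_le i) hi.le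
  have h2 := le_of_forall_lt_succ hx (show i + 1 ≤ N from hi) le_rfl
  exact Icc_subset_Icc (by linarith) (by linarith)

/-- Consistency of the method. -/
theorem IsReactionDiffusionSolution.nipgForm_eq_nipgLoad
    (hu : IsReactionDiffusionSolution ε c f u) (hε : 0 < ε)
    (hc : ContDiffOn ℝ ∞ c (Icc 0 1)) (hf : ContDiffOn ℝ ∞ f (Icc 0 1))
    (hN : 0 < N) (hx : ∀ i < N, x i < x (i + 1)) (hx0 : x 0 = 0) (hxN : x N = 1)
    {v : ℝ → ℝ} {h : ℕ → ℝ → ℝ} (hv : IsBrokenC1 N x h v) :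
    nipgForm ε c N x σ u v = nipgLoad f N x v := by
  obtain ⟨g, hg, hug⟩ := hu.exists_contDiff_extension hε hc hf
  have hub : IsBrokenC1 N x (fun _ => g) u := fun i hi =>
    ⟨hg, fun t ht => hug (Ioo_subset_Icc_self (mem_Ioo_of_mem_element hx hx0 hxN hi ht))⟩
  have hcc : ∀ i < N, ContinuousOn c (Icc (x i) (x (i + 1))) := fun i hi =>
    hc.continuousOn.mono (element_subset_Icc hx hx0 hxN hi)
  have hfc : ∀ i < N, ContinuousOn f (Icc (x i) (x (i + 1))) := fun i hi =>
    hf.continuousOn.mono (element_subset_Icc hx hx0 hxN hi)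
  have hjump : ∀ i ≤ N, nodeJump N x u i = 0 := fun i hi =>
    hub.nodeJump_eq_zero hx (φ := fun i => g (x i)) (fun _ _ => ⟨rfl, rfl⟩)
      (by rw [hx0, ← hug (by simp), hu.left_bc]) (by rw [hxN, ← hug (by simp), hu.right_bc]) hN hi
  have havg : ∀ i ≤ N, nodeAverage N x (deriv u) i = deriv g (x i) := fun i hi => by
    rw [hub.nodeAverage_deriv_eq hx hN hi]
    split_ifs with h1
    · rw [h1]
    · rfl
    · ring
  have hgu : EqOn (deriv g) (deriv u) (Ioo 0 1) := fun t ht => by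
    refine EventuallyEq.deriv_eq ?_
    filter_upwards [isOpen_Ioo.mem_nhds ht] with s hs using (hug (Ioo_subset_Icc_self hs)).symm
  have hU := hu.contDiffOn_infty hε hc hf
  -- Integration by parts on one element: by the equation, the integrand is the derivative of `ε² g'
  -- h_i`.
  have hel : ∀ i < N, (∫ t in (x i)..(x (i + 1)), (ε ^ 2 * deriv u t * deriv v t + c t * u t * v t))
      - ∫ t in (x i)..(x (i + 1)), f t * v t
      = ε ^ 2 * (deriv g (x (i + 1)) * h i (x (i + 1)) - deriv g (x i) * h i (x i)) := by
    intro i hi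
    have hI1 := hub.intervalIntegrable_form (ε := ε) hx hv hcc hi
    have hI2 := hv.intervalIntegrable_mul hx hfc hi
    rw [← intervalIntegral.integral_sub hI1 hI2]
    have hgc : Continuous (deriv g) := hg.continuous_deriv le_rfl
    have := hv.continuous hi
    rw [intervalIntegral.integral_eq_sub_of_hasDerivAt_of_le (hx i hi).le
      (f := fun t => ε ^ 2 * (deriv g t * h i t)) (by fun_prop) (fun t ht => ?_) (hI1.sub hI2)]
    · ring
    have ht01 := mem_Ioo_of_mem_element hx hx0 hxN hi ht
    have hd : HasDerivAt (deriv g) (deriv (deriv u) t) t := by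
      have h1 := hU.hasDerivAt_iteratedDeriv isOpen_Ioo 1 ht01
      simp only [iteratedDeriv_succ, iteratedDeriv_zero] at h1
      refine h1.congr_of_eventuallyEq ?_
      filter_upwards [isOpen_Ioo.mem_nhds ht01] with s hs using hgu hs
    have hdh : HasDerivAt (h i) (deriv (h i) t) t :=
      ((hv i hi).1.differentiable one_ne_zero t).hasDerivAt
    refine ((hd.mul hdh).const_mul (ε ^ 2)).congr_deriv ?_
    have heq := hu.equation t ht01
    rw [(hv i hi).2 ht, hv.eqOn_deriv hi ht, ← hgu ht01]
    linear_combination (-h i t) * heq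
  unfold nipgForm galerkinForm nipgLoad
  rw [← sub_eq_zero, add_sub_right_comm, ← Finset.sum_sub_distrib,
    Finset.sum_congr rfl fun i hi => hel i (Finset.mem_range.1 hi)]
  have hnode : ∀ i ∈ Finset.range (N + 1), ε ^ 2 * nodeAverage N x (deriv u) i * nodeJump N x v i
        - ε ^ 2 * nodeJump N x u i * nodeAverage N x (deriv v) i
        + σ i * nodeJump N x u i * nodeJump N x v i
      = ε ^ 2 * (deriv g (x i) * ((if i < N then h i (x i) else 0)
        - (if 0 < i then h (i - 1) (x i) else 0))) := by
    intro i hi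
    have hi : i ≤ N := Nat.lt_succ_iff.1 (Finset.mem_range.1 hi)
    rw [hjump i hi, havg i hi, hv.nodeJump_eq hx hN hi]
    ring
  -- The jumps of `u` vanish, so only its flux times the jumps of `v` remains; rearranged by
  -- elements, it cancels the boundary terms of `hel`.
  rw [Finset.sum_congr rfl hnode, ← Finset.mul_sum, ← Finset.mul_sum,
    sum_mul_jump_eq (fun i => deriv g (x i)) (fun i => h i (x i)) (fun i => h (i - 1) (x i)),
    ← mul_add, ← Finset.sum_add_distrib]
  simp

/-- The energy error is controlled by the error of an interpolant that matches the solution at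
the nodes. -/
theorem IsReactionDiffusionSolution.nipgForm_error_le
    (hu : IsReactionDiffusionSolution ε c f u) (hε : 0 < ε)
    (hc : ContDiffOn ℝ ∞ c (Icc 0 1)) (hf : ContDiffOn ℝ ∞ f (Icc 0 1))
    (hc0 : ∀ t ∈ Icc (0 : ℝ) 1, 0 ≤ c t)
    (hN : 0 < N) (hx : ∀ i < N, x i < x (i + 1)) (hx0 : x 0 = 0) (hxN : x N = 1)
    (hσ : ∀ i ≤ N, 0 < σ i) {uN : ℝ → ℝ} (huN : IsNIPGSolution ε c f k N x σ uN)
    {w : ℝ → ℝ} {g : ℕ → ℝ → ℝ} (hw : w ∈ dGSpace k N x) (hη : IsBrokenC1 N x g (u - w))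
    (htr : ∀ i < N, g i (x i) = 0 ∧ g i (x (i + 1)) = 0) :
    nipgForm ε c N x σ (u - uN) (u - uN) ≤ galerkinForm ε c N x (u - w) (u - w)
      + ∑ i ∈ Finset.range (N + 1), ε ^ 4 * nodeAverage N x (deriv (u - w)) i ^ 2 / σ i := by
  obtain ⟨e, he, hue⟩ := hu.exists_contDiff_extension hε hc hf
  have hub : IsBrokenC1 N x (fun _ => e) u := fun i hi =>
    ⟨he, fun t ht => hue (Ioo_subset_Icc_self (mem_Ioo_of_mem_element hx hx0 hxN hi ht))⟩
  have hcc : ∀ i < N, ContinuousOn c (Icc (x i) (x (i + 1))) := fun i hi =>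
    hc.continuousOn.mono (element_subset_Icc hx hx0 hxN hi)
  obtain ⟨p, hp⟩ := exists_isBrokenC1_of_mem_dGSpace huN.1
  have hψ := sub_mem_dGSpace huN.1 hw
  obtain ⟨q, hq⟩ := exists_isBrokenC1_of_mem_dGSpace hψ
  -- Galerkin orthogonality, which allows `u - uN` in the second argument to be replaced by `u - w`.
  have horth : nipgForm ε c N x σ (u - uN) (uN - w) = 0 := by
    rw [hub.nipgForm_sub_left hx hN hp hq hcc,
      hu.nipgForm_eq_nipgLoad hε hc hf hN hx hx0 hxN hq, huN.2 _ hψ, sub_self]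
  have hsplit : nipgForm ε c N x σ (u - uN) (u - uN) = nipgForm ε c N x σ (u - uN) (u - w) := by
    have h1 := hη.nipgForm_sub_right (σ := σ) (ε := ε) hx hN hq (hub.sub hp) hcc
    rw [horth, sub_zero] at h1
    rw [← h1]
    congr 1
    ext t
    simp
  have hJ : ∀ i ≤ N, nodeJump N x (u - w) i = 0 := fun i hi =>
    hη.nodeJump_eq_zero hx (φ := fun _ => 0) htr rfl rfl hN hi
  have hyoung := (hub.sub hp).two_mul_galerkinForm_le (ε := ε) hx hη hcc
    (fun i hi t ht => hc0 t (Ioo_subset_Icc_self (mem_Ioo_of_mem_element hx hx0 hxN hi ht)))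
  -- The two flux terms cancel on the diagonal; this is the coercivity of the nonsymmetric method.
  have hself : nipgForm ε c N x σ (u - uN) (u - uN) = galerkinForm ε c N x (u - uN) (u - uN)
      + ∑ i ∈ Finset.range (N + 1), σ i * nodeJump N x (u - uN) i ^ 2 := by
    unfold nipgForm
    congr 1
    exact Finset.sum_congr rfl fun i _ => by ring
  -- Only the product of the jump of `u - uN` with the average of `(u - w)'` survives. Young's
  -- inequality weighted by `σ i` returns exactly the penalty part of the energy, which `linarith`
  -- finally absorbs on the left.
  have hnode : 2 * ∑ i ∈ Finset.range (N + 1),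
      (ε ^ 2 * nodeAverage N x (deriv (u - uN)) i * nodeJump N x (u - w) i
        - ε ^ 2 * nodeJump N x (u - uN) i * nodeAverage N x (deriv (u - w)) i
        + σ i * nodeJump N x (u - uN) i * nodeJump N x (u - w) i)
      ≤ ∑ i ∈ Finset.range (N + 1), σ i * nodeJump N x (u - uN) i ^ 2
      + ∑ i ∈ Finset.range (N + 1), ε ^ 4 * nodeAverage N x (deriv (u - w)) i ^ 2 / σ i := by
    rw [Finset.mul_sum, ← Finset.sum_add_distrib]
    refine Finset.sum_le_sum fun i hi => ?_
    have hi : i ≤ N := Nat.lt_succ_iff.1 (Finset.mem_range.1 hi)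
    rw [hJ i hi]
    have hs := hσ i hi
    generalize nodeJump N x (u - uN) i = J
    generalize nodeAverage N x (deriv (u - w)) i = A
    have h1 : σ i * J ^ 2 + ε ^ 4 * A ^ 2 / σ i + 2 * (ε ^ 2 * J * A)
        = (σ i * J + ε ^ 2 * A) ^ 2 / σ i := by field_simp; ring
    have h2 : 0 ≤ (σ i * J + ε ^ 2 * A) ^ 2 / σ i := by positivity
    linarith
  have hform : nipgForm ε c N x σ (u - uN) (u - w) = galerkinForm ε c N x (u - uN) (u - w)
      + ∑ i ∈ Finset.range (N + 1),
      (ε ^ 2 * nodeAverage N x (deriv (u - uN)) i * nodeJump N x (u - w) i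
        - ε ^ 2 * nodeJump N x (u - uN) i * nodeAverage N x (deriv (u - w)) i
        + σ i * nodeJump N x (u - uN) i * nodeJump N x (u - w) i) := rfl
  linarith

end

/-! ### Geometry of the graded mesh -/

section

variable {ε H : ℝ}

theorem floor_inv_mul_le_one (hH : 0 < H) : (⌊1 / H⌋₊ : ℝ) * H ≤ 1 := by
  have h := Nat.floor_le (show 0 ≤ 1 / H by positivity)
  rwa [le_div_iff₀ hH] at h

theorem one_le_floor_inv (hH : 0 < H) (hH1 : H < 1) : 1 ≤ ⌊1 / H⌋₊ := by
  rw [Nat.one_le_floor_iff, le_div_iff₀ hH]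
  linarith

/-- From `1 < (⌊1/H⌋ + 1) H ≤ 2 ⌊1/H⌋ H`: the geometric part of the mesh starts at a point
comparable to `ε`. -/
theorem half_le_floor_inv_mul (hH : 0 < H) (hH1 : H < 1) : 1 / 2 ≤ (⌊1 / H⌋₊ : ℝ) * H := by
  have h1 : (1 : ℝ) ≤ ⌊1 / H⌋₊ := by exact_mod_cast one_le_floor_inv hH hH1
  have h2 := Nat.lt_floor_add_one (1 / H)
  rw [div_lt_iff₀ hH] at h2
  nlinarith

theorem gradedSeq_of_le {i : ℕ} (hi : i ≤ ⌊1 / H⌋₊) : gradedSeq ε H i = i * H * ε := by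
  rcases i with _ | i
  · simp [gradedSeq]
  · rw [gradedSeq, if_pos (by omega)]

theorem gradedSeq_succ_of_le {i : ℕ} (hi : ⌊1 / H⌋₊ ≤ i) :
    gradedSeq ε H (i + 1) = (1 + H) * gradedSeq ε H i := by
  rw [gradedSeq, if_neg (by omega)]

theorem gradedSeq_floor_add (n : ℕ) :
    gradedSeq ε H (⌊1 / H⌋₊ + n) = (1 + H) ^ n * (⌊1 / H⌋₊ * H * ε) := by
  induction n with
  | zero => rw [add_zero, gradedSeq_of_le le_rfl, pow_zero, one_mul]
  | succ n ih => rw [← add_assoc, gradedSeq_succ_of_le (Nat.le_add_right _ _), ih]; ring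

theorem gradedSeq_nonneg (hε : 0 < ε) (hH : 0 < H) (i : ℕ) : 0 ≤ gradedSeq ε H i := by
  rcases le_total i ⌊1 / H⌋₊ with h | h
  · rw [gradedSeq_of_le h]; positivity
  · obtain ⟨n, rfl⟩ := Nat.exists_eq_add_of_le h
    rw [gradedSeq_floor_add]; positivity

theorem gradedSeq_succ_sub_le (hH : 0 < H) (i : ℕ) :
    gradedSeq ε H (i + 1) - gradedSeq ε H i ≤ H * max ε (gradedSeq ε H i) := by
  rcases lt_or_ge i ⌊1 / H⌋₊ with h | h
  · rw [gradedSeq_of_le h.le, gradedSeq_of_le (show i + 1 ≤ _ from h)]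
    have := mul_le_mul_of_nonneg_left (le_max_left ε (i * H * ε)) hH.le
    push_cast
    linarith
  · rw [gradedSeq_succ_of_le h]
    have := mul_le_mul_of_nonneg_left (le_max_right ε (gradedSeq ε H i)) hH.le
    linarith

theorem gradedSeq_lt_succ (hε : 0 < ε) (hH : 0 < H) (hH1 : H < 1) (i : ℕ) :
    gradedSeq ε H i < gradedSeq ε H (i + 1) := by
  rcases lt_or_ge i ⌊1 / H⌋₊ with h | h
  · rw [gradedSeq_of_le h.le, gradedSeq_of_le (show i + 1 ≤ _ from h)]
    push_cast
    nlinarith [mul_pos hH hε]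
  · rw [gradedSeq_succ_of_le h]
    have hK : (0 : ℝ) < ⌊1 / H⌋₊ := by exact_mod_cast one_le_floor_inv hH hH1
    obtain ⟨n, rfl⟩ := Nat.exists_eq_add_of_le h
    have : 0 < gradedSeq ε H (⌊1 / H⌋₊ + n) := by rw [gradedSeq_floor_add]; positivity
    nlinarith

namespace IsGradedStop

variable {M : ℕ}

/-- The recursion cannot stop earlier: in the uniform part one would have `(1 + H) x_{M-1} ≤ (1 -
H²) ε < 1 / 2`. -/
theorem floor_lt (hM : IsGradedStop ε H M) (hε : 0 < ε) (hε2 : ε < 1 / 2) (hH : 0 < H) :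
    ⌊1 / H⌋₊ + 1 ≤ M := by
  by_contra! hlt
  obtain ⟨h1, -, h3⟩ := hM
  rw [gradedSeq_of_le (by omega)] at h3
  have h4 : ((M - 1 : ℕ) : ℝ) + 1 ≤ ⌊1 / H⌋₊ := by
    have : M - 1 + 1 ≤ ⌊1 / H⌋₊ := by omega
    exact_mod_cast this
  have h5 := floor_inv_mul_le_one hH
  have h6 : ((M - 1 : ℕ) : ℝ) * H ≤ 1 - H := by nlinarith
  have h7 : (1 + H) * (((M - 1 : ℕ) : ℝ) * H * ε) ≤ (1 + H) * ((1 - H) * ε) := by gcongr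
  nlinarith [mul_nonneg (sq_nonneg H) hε.le]

/-- The `n` geometric steps satisfy `(1 + H)^n < 1 / ε`, and `log (1 + H) ≥ H / 2`, so `n H ≤ 2 log
(1 / ε)`. The uniform part and one extra node cost at most `2`. -/
theorem mul_le_log (hM : IsGradedStop ε H M) (hε : 0 < ε) (hε2 : ε < 1 / 2) (hH : 0 < H)
    (hH1 : H < 1) : M * H ≤ 2 + 2 * Real.log (1 / ε) := by
  obtain ⟨n, rfl⟩ := Nat.exists_eq_add_of_le (hM.floor_lt hε hε2 hH)
  have h1 : gradedSeq ε H (⌊1 / H⌋₊ + n) < 1 / 2 := by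
    have := hM.2.1
    rwa [show ⌊1 / H⌋₊ + 1 + n - 1 = ⌊1 / H⌋₊ + n by omega] at this
  rw [gradedSeq_floor_add] at h1
  have h2 := half_le_floor_inv_mul hH hH1
  have h3 : (1 + H) ^ n < 1 / ε := by
    rw [lt_div_iff₀ hε]
    have h4 : (1 + H) ^ n * (1 / 2 * ε) ≤ (1 + H) ^ n * (⌊1 / H⌋₊ * H * ε) := by gcongr
    linarith
  have h5 : n * Real.log (1 + H) < Real.log (1 / ε) := by
    rw [← Real.log_pow]
    exact Real.log_lt_log (by positivity) h3
  have h6 : H / 2 ≤ Real.log (1 + H) := by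
    refine le_trans ?_ (Real.one_sub_inv_le_log_of_pos (by linarith : 0 < 1 + H))
    have e : 1 - (1 + H)⁻¹ = H / (1 + H) := by field_simp; ring
    rw [e]
    exact div_le_div_of_nonneg_left hH.le (by linarith) (by linarith)
  have h7 : (n : ℝ) * (H / 2) ≤ n * Real.log (1 + H) := by gcongr
  have h8 := floor_inv_mul_le_one hH
  push_cast
  nlinarith

end IsGradedStop

theorem two_thirds_le_log_inv (hε : 0 < ε) (hε2 : ε < 1 / 2) : 2 / 3 ≤ Real.log (1 / ε) := by
  have h1 : Real.log 2 ≤ Real.log (1 / ε) := by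
    refine Real.log_le_log (by norm_num) ?_
    rw [le_div_iff₀ hε]; linarith
  have := Real.log_two_gt_d9
  linarith

namespace IsDuranLombardi

variable {m : ℕ}

theorem pos (hm : IsDuranLombardi ε H m) (hε : 0 < ε) (hε2 : ε < 1 / 2) (hH : 0 < H)
    (hH1 : H < 1) : 0 < m := by
  have := one_le_floor_inv hH hH1
  rcases hm with h | h <;> have := h.floor_lt hε hε2 hH <;> omega

theorem mul_le_log (hm : IsDuranLombardi ε H m) (hε : 0 < ε) (hε2 : ε < 1 / 2) (hH : 0 < H)
    (hH1 : H < 1) : ((2 * m : ℕ) : ℝ) * H ≤ 10 * Real.log (1 / ε) := by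
  have hL := two_thirds_le_log_inv hε hε2
  have : m * H ≤ 2 + 2 * Real.log (1 / ε) := by
    rcases hm with h | h
    · exact h.mul_le_log hε hε2 hH hH1
    · have := h.mul_le_log hε hε2 hH hH1
      push_cast at this
      linarith
  push_cast
  linarith

theorem gradedSeq_lt_half (hm : IsDuranLombardi ε H m) (hε : 0 < ε) (hε2 : ε < 1 / 2)
    (hH : 0 < H) (hH1 : H < 1) : gradedSeq ε H (m - 1) < 1 / 2 := by
  have hpos := hm.pos hε hε2 hH hH1
  rcases hm with h | h
  · exact h.2.1
  · have h1 := h.2.1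
    have h2 := gradedSeq_lt_succ hε hH hH1 (m - 1)
    rw [Nat.sub_add_cancel hpos] at h2
    exact h2.trans h1

theorem half_sub_le (hm : IsDuranLombardi ε H m) (hε : 0 < ε) (hε2 : ε < 1 / 2)
    (hH : 0 < H) (hH1 : H < 1) :
    1 / 2 - gradedSeq ε H (m - 1) ≤ 3 * H * max ε (gradedSeq ε H (m - 1)) := by
  have hpos := hm.pos hε hε2 hH hH1
  have hle := le_max_right ε (gradedSeq ε H (m - 1))
  have hμ : 0 < max ε (gradedSeq ε H (m - 1)) := lt_max_of_lt_left hε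
  rcases hm with h | h
  · have h1 := h.2.2
    nlinarith
  · have h1 := h.2.2
    have h2 := gradedSeq_succ_sub_le (ε := ε) hH (m - 1)
    rw [Nat.sub_add_cancel hpos] at h2
    rw [Nat.add_sub_cancel] at h1
    -- If a node was omitted, two steps are merged: the first has length at most `H * max ε
    -- x_{m-1}`, the second at most twice that because `x_m` can be twice the maximum. This is the
    -- origin of the factor `3`.
    have h3 : H * max ε (gradedSeq ε H (m - 1)) ≤ max ε (gradedSeq ε H (m - 1)) :=
      mul_le_of_le_one_left hμ.le hH1.le
    have h4 : H * gradedSeq ε H m ≤ H * (2 * max ε (gradedSeq ε H (m - 1))) := by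
      gcongr; linarith
    linarith

end IsDuranLombardi

theorem gradedNode_reflect {m i : ℕ} (hi : i ≤ 2 * m) :
    gradedNode ε H m (2 * m - i) = 1 - gradedNode ε H m i := by
  unfold gradedNode
  rcases lt_trichotomy i m with h | h | h
  · rw [if_neg (by omega), if_neg (by omega), if_pos h]
    congr 2; omega
  · subst h
    rw [if_neg (by omega), if_pos (by omega), if_neg (by omega), if_pos rfl]
    norm_num
  · rw [if_pos (by omega), if_neg (by omega), if_neg (by omega)]
    ring

theorem gradedNode_zero {m : ℕ} (hm : 0 < m) : gradedNode ε H m 0 = 0 := by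
  simp [gradedNode, hm, gradedSeq]

theorem gradedNode_last {m : ℕ} (hm : 0 < m) : gradedNode ε H m (2 * m) = 1 := by
  have := gradedNode_reflect (ε := ε) (H := H) (Nat.zero_le (2 * m))
  simpa [gradedNode_zero hm] using this

variable {m : ℕ}

/-- An element of the left half of the mesh. -/
theorem IsDuranLombardi.left_element (hm : IsDuranLombardi ε H m) (hε : 0 < ε) (hε2 : ε < 1 / 2)
    (hH : 0 < H) (hH1 : H < 1) {i : ℕ} (hi : i < m) :
    0 ≤ gradedNode ε H m i ∧ gradedNode ε H m i < gradedNode ε H m (i + 1) ∧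
      gradedNode ε H m (i + 1) ≤ 1 / 2 ∧
      gradedNode ε H m (i + 1) - gradedNode ε H m i ≤ 3 * H * max ε (gradedNode ε H m i) := by
  have hmono : Monotone (gradedSeq ε H) :=
    monotone_nat_of_le_succ fun j => (gradedSeq_lt_succ hε hH hH1 j).le
  have hhalf := hm.gradedSeq_lt_half hε hε2 hH hH1
  have e1 : gradedNode ε H m i = gradedSeq ε H i := by rw [gradedNode, if_pos hi]
  have h0 := gradedSeq_nonneg hε hH i
  rw [e1]
  rcases Nat.lt_or_ge (i + 1) m with h | h
  · have e2 : gradedNode ε H m (i + 1) = gradedSeq ε H (i + 1) := by rw [gradedNode, if_pos h]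
    rw [e2]
    refine ⟨h0, gradedSeq_lt_succ hε hH hH1 i, (hmono (by omega)).trans hhalf.le, ?_⟩
    have := gradedSeq_succ_sub_le (ε := ε) hH i
    have : 0 ≤ H * max ε (gradedSeq ε H i) := mul_nonneg hH.le (le_max_of_le_left hε.le)
    linarith
  · obtain rfl : m = i + 1 := by omega
    have e2 : gradedNode ε H (i + 1) (i + 1) = 1 / 2 := by simp [gradedNode]
    rw [e2]
    exact ⟨h0, by simpa using hhalf, le_rfl, by simpa using hm.half_sub_le hε hε2 hH hH1⟩

theorem IsDuranLombardi.node_lt_succ (hm : IsDuranLombardi ε H m) (hε : 0 < ε) (hε2 : ε < 1 / 2)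
    (hH : 0 < H) (hH1 : H < 1) (i : ℕ) (hi : i < 2 * m) :
    gradedNode ε H m i < gradedNode ε H m (i + 1) := by
  rcases Nat.lt_or_ge i m with h | h
  · exact (hm.left_element hε hε2 hH hH1 h).2.1
  · obtain ⟨j, hj⟩ : ∃ j, j = 2 * m - (i + 1) := ⟨_, rfl⟩
    have h1 := (hm.left_element hε hε2 hH hH1 (show j < m by omega)).2.1
    have e1 := gradedNode_reflect (ε := ε) (H := H) (show i + 1 ≤ 2 * m from hi)
    have e2 := gradedNode_reflect (ε := ε) (H := H) hi.le
    rw [← hj] at e1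
    rw [show 2 * m - i = j + 1 by omega] at e2
    linarith

/-- The local mesh size is proportional to `H` times the distance to the boundary, cut off
at `ε`. -/
theorem IsDuranLombardi.exists_scale (hm : IsDuranLombardi ε H m) (hε : 0 < ε) (hε2 : ε < 1 / 2)
    (hH : 0 < H) (hH1 : H < 1) (i : ℕ) (hi : i < 2 * m) :
    ∃ R, ε ≤ R ∧ gradedNode ε H m (i + 1) - gradedNode ε H m i ≤ 3 * H * R ∧
      ∀ t ∈ Ioo (gradedNode ε H m i) (gradedNode ε H m (i + 1)),
        R ≤ 2 * max ε (t * (1 - t)) := by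
  -- In the left half `t (1 - t) ≥ t / 2`, so the left end point of an element gives its scale; the
  -- right half follows by reflection.
  have key : ∀ r t : ℝ, 0 ≤ r → r < t → t < 1 / 2 → max ε r ≤ 2 * max ε (t * (1 - t)) := by
    intro r t hr hrt ht
    have h1 := le_max_left ε (t * (1 - t))
    have h2 := le_max_right ε (t * (1 - t))
    refine max_le (by linarith) ?_
    nlinarith
  rcases Nat.lt_or_ge i m with h | h
  · obtain ⟨h0, -, h2, h3⟩ := hm.left_element hε hε2 hH hH1 h
    exact ⟨_, le_max_left _ _, h3, fun t ht => key _ t h0 ht.1 (ht.2.trans_le h2)⟩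
  · obtain ⟨j, hj⟩ : ∃ j, j = 2 * m - (i + 1) := ⟨_, rfl⟩
    obtain ⟨h0, -, h2, h3⟩ := hm.left_element hε hε2 hH hH1 (show j < m by omega)
    have e1 := gradedNode_reflect (ε := ε) (H := H) (show i + 1 ≤ 2 * m from hi)
    have e2 := gradedNode_reflect (ε := ε) (H := H) hi.le
    rw [← hj] at e1
    rw [show 2 * m - i = j + 1 by omega] at e2
    refine ⟨max ε (gradedNode ε H m j), le_max_left _ _, ?_, fun t ht => ?_⟩
    · rw [show gradedNode ε H m (i + 1) - gradedNode ε H m i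
        = gradedNode ε H m (j + 1) - gradedNode ε H m j by linarith]
      exact h3
    · have := key _ (1 - t) h0 (by linarith [ht.2]) (by linarith [ht.1])
      rwa [sub_sub_cancel, mul_comm (1 - t)] at this

end

/-! ### Error estimate on the graded mesh -/

theorem sum_node_penalty_le {ε H X : ℝ} {N : ℕ} {A : ℕ → ℝ} (hε : 0 < ε) (hH : 0 < H)
    (hA : ∀ i ≤ N, A i ^ 2 ≤ X / ε ^ 2) (hX : 0 ≤ X) :
    ∑ i ∈ Finset.range (N + 1), ε ^ 4 * A i ^ 2 / gradedPenalty ε H N i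
      ≤ X * ε * ((N + 1) * H + 2) := by
  -- The penalty `ε / H` gives `X ε H` at an interior node, the penalty `ε` gives `X ε` at an end
  -- node. The indicators count the end nodes.
  have hterm : ∀ i ∈ Finset.range (N + 1), ε ^ 4 * A i ^ 2 / gradedPenalty ε H N i
      ≤ X * ε * (H + (if i = 0 then 1 else 0) + (if i = N then 1 else 0)) := by
    intro i hi
    have h1 : ε ^ 4 * A i ^ 2 ≤ X * ε ^ 2 := by
      calc ε ^ 4 * A i ^ 2 ≤ ε ^ 4 * (X / ε ^ 2) := by
            gcongr; exact hA i (Nat.lt_succ_iff.1 (Finset.mem_range.1 hi))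
        _ = X * ε ^ 2 := by field_simp
    unfold gradedPenalty
    split_ifs with h2 h3 h4 h4 h5 h6
    · rw [div_le_iff₀ hε]; nlinarith [mul_nonneg hX (sq_nonneg ε)]
    · rw [div_le_iff₀ hε]; nlinarith [mul_nonneg hX (sq_nonneg ε)]
    · rw [div_le_iff₀ hε]; nlinarith [mul_nonneg hX (sq_nonneg ε)]
    · omega
    · omega
    · omega
    · omega
    · rw [div_le_iff₀ (by positivity)]
      have : X * ε * (H + 0 + 0) * (ε * H⁻¹) = X * ε ^ 2 := by field_simp; ring
      rw [this]; exact h1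
  refine (Finset.sum_le_sum hterm).trans (le_of_eq ?_)
  rw [← Finset.mul_sum, Finset.sum_add_distrib, Finset.sum_add_distrib]
  simp only [Finset.sum_const, Finset.card_range, nsmul_eq_mul, Finset.sum_ite_eq',
    Finset.mem_range, Nat.succ_pos, if_true, Nat.lt_succ_self]
  push_cast
  ring

/-- A nodally exact piecewise polynomial approximation of the solution. -/
theorem IsReactionDiffusionSolution.exists_interpolant {ε H : ℝ} {c f u : ℝ → ℝ} {k m : ℕ}
    (hu : IsReactionDiffusionSolution ε c f u) (hk : 1 ≤ k) (hε : 0 < ε) (hε2 : ε < 1 / 2)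
    (hH : 0 < H) (hH1 : H < 1) (hm : IsDuranLombardi ε H m)
    (hc : ContDiffOn ℝ ∞ c (Icc 0 1)) (hf : ContDiffOn ℝ ∞ f (Icc 0 1)) {K : ℝ}
    (hK : ∀ x ∈ Ioo (0 : ℝ) 1,
      max ε (x * (1 - x)) ^ (k + 1) * |iteratedDeriv (k + 1) u x| ≤ K) :
    ∃ (w : ℝ → ℝ) (g : ℕ → ℝ → ℝ) (R : ℕ → ℝ), w ∈ dGSpace k (2 * m) (gradedNode ε H m) ∧
      IsBrokenC1 (2 * m) (gradedNode ε H m) g (u - w) ∧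
      ∀ i < 2 * m, (g i (gradedNode ε H m i) = 0 ∧ g i (gradedNode ε H m (i + 1)) = 0) ∧
        ε ≤ R i ∧ gradedNode ε H m (i + 1) - gradedNode ε H m i ≤ 3 * H * R i ∧
        ∀ t ∈ Ioo (gradedNode ε H m i) (gradedNode ε H m (i + 1)),
          |(u - w) t| ≤ 3 * 6 ^ (k + 1) * K * H ^ (k + 1) ∧
          |deriv (u - w) t| ≤ 3 * 6 ^ (k + 1) * K * H ^ k / R i := by
  have hm0 := hm.pos hε hε2 hH hH1
  have hx := hm.node_lt_succ hε hε2 hH hH1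
  have hx0 := gradedNode_zero (ε := ε) (H := H) hm0
  have hxN := gradedNode_last (ε := ε) (H := H) hm0
  set x := gradedNode ε H m with hxdef
  set N := 2 * m with hNdef
  have hK0 : 0 ≤ K := le_trans (by positivity) (hK (1 / 2) (by norm_num))
  have hU := hu.contDiffOn_infty hε hc hf
  choose! R hRε hRh hRt using hm.exists_scale hε hε2 hH hH1
  have hR0 : ∀ i < N, 0 < R i := fun i hi => hε.trans_le (hRε i hi)
  have hsub : ∀ i < N, Ioo (x i) (x (i + 1)) ⊆ Ioo 0 1 := fun i hi t ht =>
    mem_Ioo_of_mem_element hx hx0 hxN hi ht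
  have hpoly : ∀ i < N, ∃ p : Polynomial ℝ, p.natDegree ≤ k ∧ p.eval (x i) = u (x i) ∧
      p.eval (x (i + 1)) = u (x (i + 1)) ∧ ∀ t ∈ Ioo (x i) (x (i + 1)),
      |u t - p.eval t| ≤ 2 * (2 ^ (k + 1) * K / R i ^ (k + 1)) * (x (i + 1) - x i) ^ (k + 1) ∧
      |deriv u t - p.derivative.eval t|
        ≤ 3 * (2 ^ (k + 1) * K / R i ^ (k + 1)) * (x (i + 1) - x i) ^ k := by
    intro i hi
    refine exists_polynomial_interpolant hk (hx i hi)
      (hu.continuousOn.mono (element_subset_Icc hx hx0 hxN hi)) (hU.mono (hsub i hi))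
      fun t ht => ?_
    have hR := hR0 i hi
    rw [le_div_iff₀ (by positivity)]
    -- The scale `R i` is at most twice `max ε (t (1 - t))`, which costs `2 ^ (k + 1)`; with the
    -- factor `3` in the element length this becomes `6 ^ (k + 1)`.
    calc |iteratedDeriv (k + 1) u t| * R i ^ (k + 1)
        ≤ |iteratedDeriv (k + 1) u t| * (2 * max ε (t * (1 - t))) ^ (k + 1) := by
          gcongr; exact hRt i hi t ht
      _ = 2 ^ (k + 1) * (max ε (t * (1 - t)) ^ (k + 1) * |iteratedDeriv (k + 1) u t|) := by
          rw [mul_pow]; ring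
      _ ≤ 2 ^ (k + 1) * K := by gcongr; exact hK t (hsub i hi ht)
  choose! p hp hpl hpr hpt using hpoly
  obtain ⟨w, hw⟩ := exists_glue hx fun i => (p i).eval
  have hwmem : w ∈ dGSpace k N x := fun i hi => ⟨p i, hp i hi, fun t ht => hw i hi ht⟩
  obtain ⟨e, he, hue⟩ := hu.exists_contDiff_extension hε hc hf
  have hub : IsBrokenC1 N x (fun _ => e) u := fun i hi =>
    ⟨he, fun t ht => hue (Ioo_subset_Icc_self (hsub i hi ht))⟩
  have hwb : IsBrokenC1 N x (fun i => (p i).eval) w := fun i hi =>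
    ⟨by simpa using (p i).contDiff_aeval (𝕜 := ℝ) 1, hw i hi⟩
  refine ⟨w, _, R, hwmem, hub.sub hwb, fun i hi => ?_⟩
  have hR := hR0 i hi
  have hmem := element_subset_Icc hx hx0 hxN hi
  have hxi := (hx i hi).le
  have hh0 : 0 ≤ x (i + 1) - x i := sub_nonneg.2 hxi
  refine ⟨⟨?_, ?_⟩, hRε i hi, hRh i hi, fun t ht => ⟨?_, ?_⟩⟩
  · simp [hpl i hi, hue (hmem (left_mem_Icc.2 hxi))]
  · simp [hpr i hi, hue (hmem (right_mem_Icc.2 hxi))]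
  · have h1 := (hpt i hi t ht).1
    rw [Pi.sub_apply, hw i hi ht]
    calc _ ≤ 2 * (2 ^ (k + 1) * K / R i ^ (k + 1)) * (x (i + 1) - x i) ^ (k + 1) := h1
      _ ≤ 2 * (2 ^ (k + 1) * K / R i ^ (k + 1)) * (3 * H * R i) ^ (k + 1) := by
          gcongr; exact hRh i hi
      _ = 2 * ((2 * 3) ^ (k + 1) * K * H ^ (k + 1)) := by
          rw [mul_pow, mul_pow, mul_pow]; field_simp
      _ ≤ 3 * ((2 * 3) ^ (k + 1) * K * H ^ (k + 1)) := by gcongr; norm_num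
      _ = _ := by norm_num; ring
  · have h1 := (hpt i hi t ht).2
    have hd : deriv (u - w) t = deriv u t - (p i).derivative.eval t := by
      have : deriv (u - w) t = deriv u t - deriv w t :=
        deriv_sub (hub.differentiableAt hi ht) (hwb.differentiableAt hi ht)
      rw [this, hwb.eqOn_deriv hi ht, Polynomial.deriv]
    rw [hd]
    calc _ ≤ 3 * (2 ^ (k + 1) * K / R i ^ (k + 1)) * (x (i + 1) - x i) ^ k := h1
      _ ≤ 3 * (2 ^ (k + 1) * K / R i ^ (k + 1)) * (3 * H * R i) ^ k := by
          gcongr; exact hRh i hi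
      _ = 3 * (2 ^ (k + 1) * 3 ^ k * K * H ^ k / R i) := by
          rw [mul_pow, mul_pow, pow_succ (R i)]; field_simp
      _ ≤ 3 * (2 ^ (k + 1) * 3 ^ (k + 1) * K * H ^ k / R i) := by
          gcongr <;> norm_num
      _ = _ := by rw [← mul_pow]; norm_num; ring

/-- The energy error, squared, on a graded mesh. -/
theorem IsReactionDiffusionSolution.nipgForm_error_le_of_isDuranLombardi
    {ε H : ℝ} {c f u uN : ℝ → ℝ} {k m : ℕ}
    (hu : IsReactionDiffusionSolution ε c f u) (hk : 1 ≤ k) (hε : 0 < ε) (hε2 : ε < 1 / 2)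
    (hH : 0 < H) (hH1 : H < 1) (hm : IsDuranLombardi ε H m)
    (hc : ContDiffOn ℝ ∞ c (Icc 0 1)) (hf : ContDiffOn ℝ ∞ f (Icc 0 1)) {B : ℝ} (hB : 0 ≤ B)
    (hc0 : ∀ x ∈ Icc (0 : ℝ) 1, 0 ≤ c x) (hcB : ∀ x ∈ Ioo (0 : ℝ) 1, c x ≤ B)
    (huN : IsNIPGSolution ε c f k (2 * m) (gradedNode ε H m) (gradedPenalty ε H (2 * m)) uN)
    {K : ℝ} (hK : ∀ x ∈ Ioo (0 : ℝ) 1,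
      max ε (x * (1 - x)) ^ (k + 1) * |iteratedDeriv (k + 1) u x| ≤ K) :
    nipgForm ε c (2 * m) (gradedNode ε H m) (gradedPenalty ε H (2 * m)) (u - uN) (u - uN) ≤
      (3 * 6 ^ (k + 1) * K) ^ 2 *
        (49 * (ε * Real.log (1 / ε)) * H ^ (2 * k) + B * H ^ (2 * k + 2)) := by
  obtain ⟨w, g, R, hw, hη, hall⟩ := hu.exists_interpolant hk hε hε2 hH hH1 hm hc hf hK
  have hm0 := hm.pos hε hε2 hH hH1
  have hx := hm.node_lt_succ hε hε2 hH hH1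
  have hx0 := gradedNode_zero (ε := ε) (H := H) hm0
  have hxN := gradedNode_last (ε := ε) (H := H) hm0
  have hNH := hm.mul_le_log hε hε2 hH hH1
  have hL := two_thirds_le_log_inv hε hε2
  have hK0 : 0 ≤ K := le_trans (by positivity) (hK (1 / 2) (by norm_num))
  set x := gradedNode ε H m with hxdef
  have hN0 : 0 < 2 * m := by omega
  generalize 2 * m = N at *
  set L := Real.log (1 / ε) with hLdef
  set T := 3 * 6 ^ (k + 1) * K with hT
  have hT0 : 0 ≤ T := by positivity
  have hσ : ∀ i ≤ N, 0 < gradedPenalty ε H N i := fun i _ => by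
    unfold gradedPenalty; split_ifs <;> positivity
  have hcc : ∀ i < N, ContinuousOn c (Icc (x i) (x (i + 1))) := fun i hi =>
    hc.continuousOn.mono (element_subset_Icc hx hx0 hxN hi)
  have herr := hu.nipgForm_error_le hε hc hf hc0 hN0 hx hx0 hxN hσ huN hw hη
    fun i hi => (hall i hi).1
  have hgal := hη.galerkinForm_self_le (ε := ε) hx hcc hB
    (fun i hi t ht => hcB t (mem_Ioo_of_mem_element hx hx0 hxN hi ht))
    (S := T * H ^ (k + 1)) (T := fun i => T * H ^ k / R i)
    (fun i hi t ht => ((hall i hi).2.2.2 t ht).1) (fun i hi t ht => ((hall i hi).2.2.2 t ht).2)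
  -- The gradient term is bounded element by element, since one factor `ε / R i ≤ 1` may be dropped;
  -- the reaction term uses that the lengths add up to one.
  have hsum : ∑ i ∈ Finset.range N,
      (x (i + 1) - x i) * (ε ^ 2 * (T * H ^ k / R i) ^ 2 + B * (T * H ^ (k + 1)) ^ 2)
      ≤ N * (3 * H * ε * (T * H ^ k) ^ 2) + B * (T * H ^ (k + 1)) ^ 2 := by
    have hlen : ∑ i ∈ Finset.range N, (x (i + 1) - x i) = 1 := by
      rw [Finset.sum_range_sub, hx0, hxN, sub_zero]
    simp only [mul_add, Finset.sum_add_distrib, ← Finset.sum_mul]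
    rw [hlen, one_mul]
    gcongr
    refine (Finset.sum_le_card_nsmul _ _ (3 * H * ε * (T * H ^ k) ^ 2) fun i hi => ?_).trans_eq
      (by simp)
    obtain ⟨-, hR, hh, -⟩ := hall i (Finset.mem_range.1 hi)
    have hR0 : 0 < R i := hε.trans_le hR
    calc (x (i + 1) - x i) * (ε ^ 2 * (T * H ^ k / R i) ^ 2)
        ≤ (3 * H * R i) * (ε ^ 2 * (T * H ^ k / R i) ^ 2) := by gcongr
      _ = 3 * H * ε * (T * H ^ k) ^ 2 * (ε / R i) := by field_simp
      _ ≤ 3 * H * ε * (T * H ^ k) ^ 2 * 1 := by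
          gcongr; exact (div_le_one hR0).2 hR
      _ = _ := mul_one _
  have havg : ∀ i ≤ N, nodeAverage N x (deriv (u - w)) i ^ 2 ≤ (T * H ^ k) ^ 2 / ε ^ 2 := by
    intro i hi
    rw [← div_pow, ← sq_abs]
    gcongr
    refine hη.abs_nodeAverage_deriv_le hx (fun j hj t ht => ?_) hN0 hi
    obtain ⟨-, hR, -, h2⟩ := hall j hj
    refine (h2 t ht).2.trans ?_
    gcongr
  have hnode := sum_node_penalty_le hε hH havg (by positivity)
  -- The bracket `4 N H + H + 2` is at most `40 L + 3`, and `L ≥ 2 / 3`. The constant `49` is not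
  -- sharp; as a square it gives `7` after taking the root.
  have hfac : N * (3 * H * ε * (T * H ^ k) ^ 2) + (T * H ^ k) ^ 2 * ε * ((N + 1) * H + 2)
      ≤ (T * H ^ k) ^ 2 * ε * (49 * L) := by
    have h1 : (N : ℝ) * (3 * H * ε * (T * H ^ k) ^ 2)
        + (T * H ^ k) ^ 2 * ε * ((N + 1) * H + 2)
        = (T * H ^ k) ^ 2 * ε * (4 * (N * H) + H + 2) := by ring
    rw [h1]
    gcongr
    linarith
  have hfinal : T ^ 2 * (49 * (ε * L) * H ^ (2 * k) + B * H ^ (2 * k + 2))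
      = (T * H ^ k) ^ 2 * ε * (49 * L) + B * (T * H ^ (k + 1)) ^ 2 := by ring
  rw [hfinal]
  linarith

theorem theorem2 (k : ℕ) (hk : 1 ≤ k) (c f : ℝ → ℝ)
    (hc : ContDiffOn ℝ ∞ c (Set.Icc 0 1)) (hf : ContDiffOn ℝ ∞ f (Set.Icc 0 1))
    (γ : ℝ) (hγ : 0 < γ ^ 2) (hcγ : ∀ x ∈ Set.Icc (0 : ℝ) 1, γ ^ 2 ≤ c x) :
    ∃ C : ℝ, 0 < C ∧
      ∀ ε : ℝ, 0 < ε → ε < 1 / 2 → ∀ H : ℝ, 0 < H → H < 1 →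
      ∀ m : ℕ, IsDuranLombardi ε H m → ∀ N : ℕ, N = 2 * m →
        H ≤ C * (Real.log (1 / ε) / N) ∧
        ∀ u uN : ℝ → ℝ, IsReactionDiffusionSolution ε c f u →
          IsNIPGSolution ε c f k N (gradedNode ε H m) (gradedPenalty ε H N) uN →
            dGNorm ε c N (gradedNode ε H m) (gradedPenalty ε H N) (u - uN)
                ≤ C * H ^ (k + 1) + C * Real.sqrt (ε * Real.log (1 / ε)) * H ^ k
              ∧ dGNorm ε c N (gradedNode ε H m) (gradedPenalty ε H N) (u - uN)
                ≤ C * (N : ℝ) ^ (-(k : ℤ)) * Real.log (1 / ε) ^ k := by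
  obtain ⟨K, hK0, hK⟩ := exists_bound_iteratedDeriv_solution hc hf hγ hcγ (k + 1)
  obtain ⟨B, hB0, hB⟩ := hc.exists_bound_iteratedDeriv 0
  simp only [iteratedDeriv_zero] at hB
  set T := 3 * 6 ^ (k + 1) * K with hT
  set D := T * (7 + Real.sqrt B) with hD
  have hD0 : 0 ≤ D := by positivity
  -- The summand `10` serves the bound on `H`, the other one the estimate in `N`, where `H ^ k` is
  -- replaced by `(10 log (1 / ε) / N) ^ k`.
  refine ⟨10 + 2 * D * 10 ^ k, by positivity, ?_⟩
  rintro ε hε hε2 H hH hH1 m hm N rfl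
  have hm0 := hm.pos hε hε2 hH hH1
  have hNpos : (0 : ℝ) < (2 * m : ℕ) := by exact_mod_cast (by omega : 0 < 2 * m)
  have hNH := hm.mul_le_log hε hε2 hH hH1
  have hL : 0 ≤ Real.log (1 / ε) := by linarith [two_thirds_le_log_inv hε hε2]
  have hDC : D ≤ 10 + 2 * D * 10 ^ k := by
    have : (1 : ℝ) ≤ 10 ^ k := one_le_pow₀ (by norm_num)
    nlinarith
  have hH10 : H ≤ 10 * (Real.log (1 / ε) / (2 * m : ℕ)) := by
    rw [mul_div_assoc', le_div_iff₀ hNpos]; linarith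
  refine ⟨hH10.trans ?_, fun u uN hu huN => ?_⟩
  · gcongr
    have : 0 ≤ 2 * D * 10 ^ k := by positivity
    linarith
  have hmain : dGNorm ε c (2 * m) (gradedNode ε H m) (gradedPenalty ε H (2 * m)) (u - uN)
      ≤ D * H ^ (k + 1) + D * Real.sqrt (ε * Real.log (1 / ε)) * H ^ k := by
    have h1 := hu.nipgForm_error_le_of_isDuranLombardi hk hε hε2 hH hH1 hm hc hf hB0
      (fun x hx => hγ.le.trans (hcγ x hx)) (fun x hx => (le_abs_self _).trans (hB x hx)) huN
      (hK ε hε hε2 u hu)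
    rw [← hT] at h1
    unfold dGNorm
    set s := Real.sqrt (ε * Real.log (1 / ε)) with hs
    have hs0 : 0 ≤ s := Real.sqrt_nonneg _
    have hs2 : s ^ 2 = ε * Real.log (1 / ε) := Real.sq_sqrt (by positivity)
    have hb2 : Real.sqrt B ^ 2 = B := Real.sq_sqrt hB0
    have h2 : nipgForm ε c (2 * m) (gradedNode ε H m) (gradedPenalty ε H (2 * m)) (u - uN) (u - uN)
        ≤ (T * (7 * s * H ^ k + Real.sqrt B * H ^ (k + 1))) ^ 2 := by
      refine h1.trans ?_
      rw [mul_pow T]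
      refine mul_le_mul_of_nonneg_left ?_ (sq_nonneg T)
      rw [← hs2]
      nth_rw 1 [← hb2]
      have : 0 ≤ 2 * (7 * s * H ^ k) * (Real.sqrt B * H ^ (k + 1)) := by positivity
      calc 49 * s ^ 2 * H ^ (2 * k) + Real.sqrt B ^ 2 * H ^ (2 * k + 2)
          = (7 * s * H ^ k) ^ 2 + (Real.sqrt B * H ^ (k + 1)) ^ 2 := by ring
        _ ≤ _ := by rw [add_sq]; linarith
    refine (Real.sqrt_le_sqrt h2).trans ?_
    rw [Real.sqrt_sq (by positivity)]
    have h3 : 0 ≤ T * 7 * H ^ (k + 1) := by positivity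
    have h4 : 0 ≤ T * Real.sqrt B * s * H ^ k := by positivity
    rw [hD]
    linarith
  refine ⟨hmain.trans (by gcongr), hmain.trans ?_⟩
  -- From `log y ≤ y - 1` one has `ε log (1 / ε) ≤ 1 - ε`, so the second term is no worse than `H ^
  -- k`.
  have hs1 : Real.sqrt (ε * Real.log (1 / ε)) ≤ 1 := by
    rw [Real.sqrt_le_one]
    have h1 := Real.log_le_sub_one_of_pos (by positivity : 0 < 1 / ε)
    have h2 : ε * Real.log (1 / ε) ≤ ε * (1 / ε - 1) := by gcongr
    have h3 : ε * (1 / ε - 1) = 1 - ε := by field_simp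
    linarith
  have hHk : H ^ (k + 1) ≤ H ^ k := pow_le_pow_of_le_one hH.le hH1.le (Nat.le_succ k)
  calc D * H ^ (k + 1) + D * Real.sqrt (ε * Real.log (1 / ε)) * H ^ k
      ≤ D * H ^ k + D * 1 * H ^ k := by gcongr
    _ = 2 * D * H ^ k := by ring
    _ ≤ 2 * D * (10 * (Real.log (1 / ε) / (2 * m : ℕ))) ^ k :=
        mul_le_mul_of_nonneg_left (pow_le_pow_left₀ hH.le hH10 k) (by positivity)
    _ = 2 * D * 10 ^ k * ((2 * m : ℕ) : ℝ) ^ (-(k : ℤ)) * Real.log (1 / ε) ^ k := by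
        rw [zpow_neg, zpow_natCast, mul_pow, div_pow]; ring
    _ ≤ _ := by gcongr; linarith
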